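/- Let $T>0$, let $D\subseteq\mathbf R^n$ be an open set such that either $D=\mathbf R^n$ or $D$ is bounded with $C^2$-smooth boundary, let $Q=D\times(0,T)$, and let $\delta>0$ and $\Lambda$ be constants. Consider coefficients $b$ (with values in the symmetric $n\times n$ matrices), $f$ (with values in $\mathbf R^n$) and $\lambda$ (real-valued) which are measurable on $Q$ and satisfy $\xi^\top b(x,t)\xi\ge\delta|\xi|^2$ for all $\xi\in\mathbf R^n$, $(x,t)\in Q$, as well as $$\mathop{\rm ess\,sup}_{Q}\bigl[|b|+|b^{-1}|+|f|+|\lambda|\bigr]<\infty,\qquad \mathop{\rm ess\,sup}_{Q}\bigl[|b|+|f|+|\lambda|\bigr]\le\Lambda,$$ where $|\cdot|$ is the Euclidean norm of vectors and the Frobenius norm of matrices. Let $\mathcal A y=\nabla\cdot(b\nabla y)+f\cdot\nabla y+\lambda y$. Let $H^0=L_2(D)$, let $H^1$ be the closure of $C_c^\infty(D)$ in the norm of $W_2^1(D)$, let $H^{-1}$ be the dual of $H^1$, and let $X^k=L^2([0,T];H^k)$ and $Y^1=X^1\cap C([0,T];H^0)$. For $\varphi\in X^{-1}$, a solution of $$\frac{\partial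 u}{\partial t}=\mathcal A u+\varphi\ \text{ in } Q,\qquad u(\cdot,0)=0,\qquad u|_{\partial D}=0$$ is a function $u\in Y^1$ with $u(\cdot,0)=0$ and $u(\cdot,t)=\int_0^t(\mathcal A u+\varphi)(\cdot,s)\,ds$ in $H^{-1}$ for all $t\in[0,T]$. Then for all $M>0$ and $\varepsilon>0$ there is a constant $K\ge0$, depending only on $n,T,D,\delta,\Lambda,M,\varepsilon$, such that for all such coefficients $b,f,\lambda$, all $\varphi\in X^{-1}$, all $F_0,F_1,\dots,F_n\in X^0$ with $\varphi=\nabla\cdot F+F_0$, $F=(F_1,\dots,F_n)$, the solution $u$ of this problem satisfies, for all $t\in[0,T]$, $$\sup_{s\in[0,t]}e^{-2Ks}\|u(\cdot,s)\|_{H^0}^2+M\int_0^te^{-2Ks}\|u(\cdot,s)\|_{H^0}^2\,ds\le\Bigl(\frac12+\varepsilon\Bigr)\int_0^t\bigl(F(\cdot,s),b(\cdot,s)^{-1}F(\cdot,s)\bigr)_{H^0}\,ds+\varepsilon\int_0^t\|F_0(\cdot,s)\|_{H^0}^2\,ds.$$ -/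

import Mathlib

open MeasureTheory Set
open scoped ContDiff ENNReal Matrix

noncomputable section

namespace Parabolic

/-- The Euclidean space `ℝⁿ`. -/
abbrev E (n : ℕ) : Type := EuclideanSpace ℝ (Fin n)

/-- Lebesgue measure on `D ⊆ ℝⁿ`. -/
abbrev spaceMeasure {n : ℕ} (D : Set (E n)) : Measure (E n) := volume.restrict D

/-- Lebesgue measure on the time interval `[0, T]`. -/
abbrev timeMeasure (T : ℝ) : Measure ℝ := volume.restrict (Icc (0 : ℝ) T)

/-- The cylinder `Q = D × (0, T)`. -/
def cylinder {n : ℕ} (D : Set (E n)) (T : ℝ) : Set (E n × ℝ) := D ×ˢ Ioo (0 : ℝ) T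

/-- The boundary of the open set `D` is `C²`-smooth: near each of its boundary points `D` is the
positivity set of a `C²` function whose differential does not vanish at that point. -/
def HasC2Boundary {n : ℕ} (D : Set (E n)) : Prop :=
  ∀ p ∈ frontier D, ∃ U : Set (E n), IsOpen U ∧ p ∈ U ∧
    ∃ g : E n → ℝ, ContDiffOn ℝ 2 g U ∧ fderiv ℝ g p ≠ 0 ∧ D ∩ U = {x ∈ U | 0 < g x}

/-- The spatial domains: `D` is open, and either `D = ℝⁿ` or `D` is bounded with `C²` boundary. -/
def IsSpatialDomain {n : ℕ} (D : Set (E n)) : Prop :=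
  IsOpen D ∧ (D = univ ∨ (Bornology.IsBounded D ∧ HasC2Boundary D))

/-! ### Function spaces in the space variable -/

/-- `H⁰ = L₂(D)`. -/
abbrev H0 {n : ℕ} (D : Set (E n)) : Type := Lp ℝ 2 (spaceMeasure D)

/-- `L₂(D; ℝⁿ)`. -/
abbrev H0Vec {n : ℕ} (D : Set (E n)) : Type := Lp (E n) 2 (spaceMeasure D)

/-- `φ` is a smooth function with compact support contained in `D`. -/
structure IsTestFunction {n : ℕ} (D : Set (E n)) (φ : E n → ℝ) : Prop where
  smooth : ContDiff ℝ ∞ φ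
  hasCompactSupport : HasCompactSupport φ
  tsupport_subset : tsupport φ ⊆ D

/-- The pairs `(φ, ∇φ)`, for `φ` a test function on `D`, in the Hilbert space
`L₂(D) × L₂(D; ℝⁿ)`, whose norm `(‖v‖² + ‖G‖²)^{1/2}` on such pairs is the `W₂¹(D)`-norm. -/
def testGraph {n : ℕ} (D : Set (E n)) : Submodule ℝ (WithLp 2 (H0 D × H0Vec D)) where
  carrier := {p | ∃ φ : E n → ℝ, IsTestFunction D φ ∧
    p.fst =ᵐ[spaceMeasure D] φ ∧ p.snd =ᵐ[spaceMeasure D] gradient φ}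
  zero_mem' := by
    refine ⟨0, ⟨contDiff_const, HasCompactSupport.zero, by simp [tsupport]⟩, ?_, ?_⟩
    · exact Lp.coeFn_zero _ _ _
    · have h : gradient (0 : E n → ℝ) = 0 := by
        funext x; simp [gradient]
      rw [h]; exact Lp.coeFn_zero _ _ _
  add_mem' := by
    rintro p q ⟨φ, hφ, hp₁, hp₂⟩ ⟨ψ, hψ, hq₁, hq₂⟩
    refine ⟨φ + ψ, ⟨hφ.smooth.add hψ.smooth, hφ.hasCompactSupport.add hψ.hasCompactSupport,
      (tsupport_add φ ψ).trans (union_subset hφ.tsupport_subset hψ.tsupport_subset)⟩, ?_, ?_⟩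
    · exact (Lp.coeFn_add p.fst q.fst).trans (hp₁.add hq₁)
    · have h : gradient (φ + ψ) = gradient φ + gradient ψ := by
        funext x
        have h₁ : DifferentiableAt ℝ φ x := (hφ.smooth.differentiable (by simp)) x
        have h₂ : DifferentiableAt ℝ ψ x := (hψ.smooth.differentiable (by simp)) x
        simp [gradient, fderiv_add h₁ h₂]
      rw [h]
      exact (Lp.coeFn_add p.snd q.snd).trans (hp₂.add hq₂)
  smul_mem' := by
    rintro c p ⟨φ, hφ, hp₁, hp₂⟩
    refine ⟨c • φ, ⟨hφ.smooth.const_smul c, hφ.hasCompactSupport.smul_left (f := fun _ => c),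
      (closure_mono (Function.support_const_smul_subset c φ)).trans hφ.tsupport_subset⟩, ?_, ?_⟩
    · exact (Lp.coeFn_smul c p.fst).trans (hp₁.const_smul c)
    · have h : gradient (c • φ) = c • gradient φ := by
        funext x
        have h₁ : DifferentiableAt ℝ φ x := (hφ.smooth.differentiable (by simp)) x
        simp [gradient, fderiv_const_smul h₁ c]
      rw [h]
      exact (Lp.coeFn_smul c p.snd).trans (hp₂.const_smul c)

/-- `H¹`, the closure of the test functions in the `W₂¹(D)`-norm. An element is the pair of a
function and its (weak) gradient. -/
abbrev H1 {n : ℕ} (D : Set (E n)) : Type := ↥(testGraph D).topologicalClosure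

/-- The function `v ∈ L₂(D)` underlying an element of `H¹`. -/
def H1.val {n : ℕ} {D : Set (E n)} (v : H1 D) : H0 D := (v : WithLp 2 (H0 D × H0Vec D)).fst

/-- The gradient `∇v ∈ L₂(D; ℝⁿ)` of an element `v` of `H¹`. -/
def H1.grad {n : ℕ} {D : Set (E n)} (v : H1 D) : H0Vec D := (v : WithLp 2 (H0 D × H0Vec D)).snd

/-- `H⁻¹`, the dual space of `H¹`. -/
abbrev Hneg {n : ℕ} (D : Set (E n)) : Type := StrongDual ℝ (H1 D)

/-! ### Function spaces in space and time -/

/-- `X⁰ = L²([0, T]; H⁰)`. -/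
abbrev X0 {n : ℕ} (D : Set (E n)) (T : ℝ) : Type := Lp (H0 D) 2 (timeMeasure T)

/-- `(X⁰)ⁿ = L²([0, T]; L₂(D; ℝⁿ))`. -/
abbrev X0Vec {n : ℕ} (D : Set (E n)) (T : ℝ) : Type := Lp (H0Vec D) 2 (timeMeasure T)

/-- `X¹ = L²([0, T]; H¹)`. -/
abbrev X1 {n : ℕ} (D : Set (E n)) (T : ℝ) : Type := Lp (H1 D) 2 (timeMeasure T)

/-- `X⁻¹ = L²([0, T]; H⁻¹)`. -/
abbrev Xneg {n : ℕ} (D : Set (E n)) (T : ℝ) : Type := Lp (Hneg D) 2 (timeMeasure T)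

/-- `Y¹ = X¹ ∩ C([0, T]; H⁰)`: an element of `X¹` together with its continuous version
with values in `H⁰`. -/
structure Y1 {n : ℕ} (D : Set (E n)) (T : ℝ) where
  toX1 : X1 D T
  toC0 : C(Icc (0 : ℝ) T, H0 D)
  ae_eq : ∀ᵐ s ∂(timeMeasure T), ∀ hs : s ∈ Icc (0 : ℝ) T, toC0 ⟨s, hs⟩ = (toX1 s).val

/-! ### The coefficients -/

/-- The Frobenius norm of a matrix. -/
def frobNorm {n : ℕ} (A : Matrix (Fin n) (Fin n) ℝ) : ℝ := √(∑ i, ∑ j, A i j ^ 2)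

/-- The coefficients `b(x,t)`, `f(x,t)`, `λ(x,t)` of the parabolic operator. -/
structure Coefficients (n : ℕ) where
  b : E n → ℝ → Matrix (Fin n) (Fin n) ℝ
  f : E n → ℝ → E n
  lam : E n → ℝ → ℝ

/-- The conditions on the coefficients: measurability, symmetry of `b`, coercivity with the
constant `δ`, and essential boundedness of `|b| + |b⁻¹| + |f| + |λ|` on `Q = D × (0,T)`. -/
structure Coefficients.IsAdmissible {n : ℕ} (c : Coefficients n) (D : Set (E n)) (T δ : ℝ) :
    Prop where
  measurable_b : ∀ i j,
    AEMeasurable (fun p : E n × ℝ => c.b p.1 p.2 i j) (volume.restrict (cylinder D T))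
  measurable_f : AEMeasurable (fun p : E n × ℝ => c.f p.1 p.2) (volume.restrict (cylinder D T))
  measurable_lam :
    AEMeasurable (fun p : E n × ℝ => c.lam p.1 p.2) (volume.restrict (cylinder D T))
  symm : ∀ p ∈ cylinder D T, (c.b p.1 p.2).IsSymm
  coercive : ∀ p ∈ cylinder D T, ∀ ξ : E n,
    δ * ‖ξ‖ ^ 2 ≤ ξ.ofLp ⬝ᵥ (c.b p.1 p.2 *ᵥ ξ.ofLp)
  bounded : ∃ C : ℝ, ∀ᵐ p ∂(volume.restrict (cylinder D T)),
    frobNorm (c.b p.1 p.2) + frobNorm (c.b p.1 p.2)⁻¹ + ‖c.f p.1 p.2‖ + |c.lam p.1 p.2| ≤ C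

/-- `Λ` is an essential upper bound of `|b| + |f| + |λ|` on `Q`. -/
def Coefficients.EssBoundedBy {n : ℕ} (c : Coefficients n) (D : Set (E n)) (T Λ : ℝ) : Prop :=
  ∀ᵐ p ∂(volume.restrict (cylinder D T)),
    frobNorm (c.b p.1 p.2) + ‖c.f p.1 p.2‖ + |c.lam p.1 p.2| ≤ Λ

/-- The value `(𝒜(s) v, w)_{H⁰}` of the functional `𝒜(s) v ∈ H⁻¹` at `w ∈ H¹`, where
`𝒜 v = ∇ · (b ∇v) + f · ∇v + λ v`. -/
def Coefficients.form {n : ℕ} (c : Coefficients n) {D : Set (E n)} (s : ℝ) (v w : H1 D) : ℝ :=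
  -(∫ x in D, (w.grad x).ofLp ⬝ᵥ (c.b x s *ᵥ (v.grad x).ofLp))
    + (∫ x in D, inner ℝ (c.f x s) (v.grad x) * w.val x)
    + ∫ x in D, c.lam x s * v.val x * w.val x

/-- `(F, b(·,s)⁻¹ F)_{H⁰}` for a vector field `F ∈ L₂(D; ℝⁿ)`. -/
def Coefficients.invForm {n : ℕ} (c : Coefficients n) {D : Set (E n)} (s : ℝ) (F : H0Vec D) : ℝ :=
  ∫ x in D, (F x).ofLp ⬝ᵥ ((c.b x s)⁻¹ *ᵥ (F x).ofLp)

/-- `φ = ∇ · F + F₀` as elements of `X⁻¹`. -/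
def IsDivergenceForm {n : ℕ} {D : Set (E n)} {T : ℝ} (φ : Xneg D T) (F : X0Vec D T)
    (F₀ : X0 D T) : Prop :=
  ∀ᵐ s ∂(timeMeasure T), ∀ w : H1 D,
    φ s w = -(inner ℝ (F s) w.grad) + inner ℝ (F₀ s) w.val

/-- `u ∈ Y¹` is the solution of `∂u/∂t = 𝒜 u + φ`, `u(·,0) = 0`, `u = 0` on `∂D`: the boundary
condition is contained in `u ∈ X¹`, and the equation means `u(·,t) = ∫₀ᵗ (𝒜 u + φ) ds` in `H⁻¹`
for all `t ∈ [0, T]`, an equality which is tested here with all `w ∈ H¹`. -/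
structure IsSolution {n : ℕ} {D : Set (E n)} {T : ℝ} (c : Coefficients n) (φ : Xneg D T)
    (u : Y1 D T) : Prop where
  initial : ∀ t : Icc (0 : ℝ) T, (t : ℝ) = 0 → u.toC0 t = 0
  equation : ∀ (t : Icc (0 : ℝ) T) (w : H1 D),
    inner ℝ (u.toC0 t) w.val = ∫ s in (0 : ℝ)..t, (c.form s (u.toX1 s) w + φ s w)

end Parabolic

end

namespace Parabolic

open Filter Topology


/-! ### Weak and strong measurability -/

/-! The proof is a weighted energy estimate. Testing the equation with `u` itself gives
`e^{-2Kt}‖u(t)‖² + 2K∫e^{-2Ks}‖u‖² ≤ 2∫e^{-2Ks}⟨𝒜u + φ, u⟩` (`energy_inequality`). Pointwise in `(x,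
s)`, Young's inequality in the metric of `b` splits off `(1/2 + e) F·b⁻¹F` at the price of slightly
less than the whole dissipation `2 ∇u·b∇u`. The small remainder, bounded below by coercivity,
absorbs the drift, so that everything else is at most `e F₀² + C u²` with `C` depending only on `δ,
Λ, e` (`pointwise_energy_estimate`). Taking `2K = L + C` cancels `C` and leaves `L∫e^{-2Ks}‖u‖²` on
the left (`IsSolution.energy_estimate`). As `L` is free, a large `L` makes the `M`-term a small
fraction of the right side, while the supremum is bounded by using the estimate at every `s ≤ t`.

The delicate point is that `u` has a time derivative only in `H⁻¹`, so the chain rule for `‖u‖²` is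
not available directly. It is replaced by comparing `u(s)` with `u(s - h)`, integrating in `s`, and
differentiating at `h = 0`; continuity of translations in `L²` gives the limit. The essential bound
on `|b⁻¹|` enters only measurability and integrability arguments, never `K`. -/

theorem countable_of_orthonormal {V : Type*} [NormedAddCommGroup V] [InnerProductSpace ℝ V]
    [TopologicalSpace.SeparableSpace V] {w : Set V} (hw : Orthonormal ℝ ((↑) : w → V)) :
    w.Countable := by
  -- Distinct orthonormal vectors are `√2` apart, so balls of radius `1/2` around them are disjoint,
  -- and separability permits only countably many.
  have key : ∀ x ∈ w, ∀ y ∈ w, x ≠ y → ‖x - y‖ ^ 2 = 2 := by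
    intro x hx y hy hxy
    have h1 : ‖x‖ = 1 := hw.1 ⟨x, hx⟩
    have h2 : ‖y‖ = 1 := hw.1 ⟨y, hy⟩
    have h3 : inner ℝ x y = 0 := hw.2 (i := ⟨x, hx⟩) (j := ⟨y, hy⟩) (by simpa using hxy)
    rw [norm_sub_sq_real, h1, h2, h3]; norm_num
  refine Set.PairwiseDisjoint.countable_of_isOpen (s := fun x : V => Metric.ball x (1 / 2)) ?_
    (fun _ _ => Metric.isOpen_ball) (fun x _ => ⟨x, by simp⟩)
  intro x hx y hy hxy
  refine Metric.ball_disjoint_ball ?_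
  rw [dist_eq_norm]
  nlinarith [key x hx y hy hxy, norm_nonneg (x - y)]

/-- Pettis' theorem in a separable Hilbert space. -/
theorem aestronglyMeasurable_of_inner {α V : Type*} [MeasurableSpace α] {μ : Measure α}
    [NormedAddCommGroup V] [InnerProductSpace ℝ V] [CompleteSpace V]
    [TopologicalSpace.SeparableSpace V] {q : α → V}
    (h : ∀ w, AEStronglyMeasurable (fun s => inner ℝ (q s) w) μ) : AEStronglyMeasurable q μ := by
  obtain ⟨w, b, hb⟩ := exists_hilbertBasis ℝ V
  have hc : w.Countable := countable_of_orthonormal (hb ▸ b.orthonormal)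
  have : Countable w := hc.to_subtype
  refine aestronglyMeasurable_of_tendsto_ae (atTop : Filter (Finset w))
    (f := fun S s => ∑ i ∈ S, (b.repr (q s)) i • b i) ?_
    (Eventually.of_forall fun s => b.hasSum_repr (q s))
  intro S
  refine Finset.aestronglyMeasurable_fun_sum _ fun i _ => ?_
  refine AEStronglyMeasurable.smul_const ?_ _
  simp_rw [b.repr_apply_apply, real_inner_comm]
  exact h _


/-! ### Square-integrable functions -/

theorem memLp_two_inner_integrable {α V : Type*} [MeasurableSpace α] {μ : Measure α}
    [NormedAddCommGroup V] [InnerProductSpace ℝ V] {f g : α → V} (hf : MemLp f 2 μ)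
    (hg : MemLp g 2 μ) : Integrable (fun s => inner ℝ (f s) (g s)) μ := by
  refine (L2.integrable_inner (𝕜 := ℝ) (hf.toLp f) (hg.toLp g)).congr ?_
  filter_upwards [hf.coeFn_toLp, hg.coeFn_toLp] with s h1 h2
  rw [h1, h2]

/-- A measurable family of uniformly bounded bilinear forms maps square-integrable functions to
square-integrable functions. -/
theorem exists_memLp_two_inner_eq {α V : Type*} [MeasurableSpace α] {μ : Measure α}
    [NormedAddCommGroup V] [InnerProductSpace ℝ V] [CompleteSpace V]
    [TopologicalSpace.SeparableSpace V] {a : α → V → V → ℝ} {C : ℝ}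
    (ha : ∀ᵐ s ∂μ, ∃ B : V →L[ℝ] V →L[ℝ] ℝ, ∀ v w, B v w = a s v w)
    (hC : ∀ᵐ s ∂μ, ∀ v w, |a s v w| ≤ C * ‖v‖ * ‖w‖)
    (hm : ∀ v w, AEStronglyMeasurable (fun s => a s v w) μ) {U : α → V} (hU : MemLp U 2 μ) :
    ∃ G : α → V, MemLp G 2 μ ∧ ∀ᵐ s ∂μ, ∀ w, inner ℝ (G s) w = a s (U s) w := by
  classical
  -- A globally defined family of bounded forms, set to zero on the exceptional null set.
  let B : α → V →L[ℝ] V →L[ℝ] ℝ := fun s =>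
    if hs : ∃ B : V →L[ℝ] V →L[ℝ] ℝ, ∀ v w, B v w = a s v w then hs.choose else 0
  have hB : ∀ᵐ s ∂μ, ∀ v w, B s v w = a s v w := by
    filter_upwards [ha] with s hs v w
    simp only [B, dif_pos hs, hs.choose_spec]
  have hBm : ∀ v w, AEStronglyMeasurable (fun s => B s v w) μ := fun v w =>
    (hm v w).congr (by filter_upwards [hB] with s hs using (hs v w).symm)
  -- Measurability is known only for fixed arguments. To insert `U s` in the first slot, represent
  -- `v ↦ B s v w` by a vector, strongly measurable by Pettis, and pair it with `U s`; a second use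
  -- of Pettis then handles the slot `w`.
  have hleft : ∀ w, AEStronglyMeasurable (fun s => B s (U s) w) μ := by
    intro w
    have h1 : AEStronglyMeasurable
        (fun s => (InnerProductSpace.toDual ℝ V).symm ((B s).flip w)) μ :=
      aestronglyMeasurable_of_inner fun v => by simpa using hBm v w
    simpa using h1.inner (𝕜 := ℝ) hU.1
  have hG : AEStronglyMeasurable (fun s => (InnerProductSpace.toDual ℝ V).symm (B s (U s))) μ :=
    aestronglyMeasurable_of_inner fun w => by simpa using hleft w
  have hGe : ∀ᵐ s ∂μ, ∀ w,
      inner ℝ ((InnerProductSpace.toDual ℝ V).symm (B s (U s))) w = a s (U s) w := by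
    filter_upwards [hB] with s hs w
    simp [hs]
  refine ⟨_, hU.of_le_mul (c := C) hG ?_, hGe⟩
  filter_upwards [hGe, hC] with s h1 h2
  set p := (InnerProductSpace.toDual ℝ V).symm (B s (U s))
  have h3 : ‖p‖ * ‖p‖ ≤ C * ‖U s‖ * ‖p‖ := by
    rw [← real_inner_self_eq_norm_mul_norm, h1 p]
    exact (le_abs_self _).trans (h2 _ _)
  rcases (norm_nonneg p).eq_or_lt with h0 | h0
  -- The sign of `C` is not assumed; a negative `C` forces `U s = 0`, by the bound at `(U s, U s)`.
  · rw [← h0]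
    by_contra hcon
    have h4 := h2 (U s) (U s)
    have h5 := abs_nonneg (a s (U s) (U s))
    have h6 : 0 < ‖U s‖ := by
      rcases (norm_nonneg (U s)).eq_or_lt with h | h
      · rw [← h] at hcon; simp at hcon
      · exact h
    nlinarith
  · exact le_of_mul_le_mul_right h3 h0

/-- Translations act continuously on `L²(ℝ)`. -/
theorem continuous_integral_inner_translate {V : Type*} [NormedAddCommGroup V]
    [InnerProductSpace ℝ V] {f g : ℝ → V} (hf : MemLp f 2 (volume : Measure ℝ))
    (hg : MemLp g 2 (volume : Measure ℝ)) :
    Continuous fun r : ℝ => ∫ s, inner ℝ (f (s - r)) (g s) := by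
  have : Fact ((2 : ℝ≥0∞) ≠ ⊤) := ⟨by norm_num⟩
  have h : Continuous fun r : ℝ =>
      (inner ℝ (DomAddAct.mk (-r) +ᵥ hf.toLp f) (hg.toLp g) : ℝ) := by
    refine Continuous.inner ?_ continuous_const
    exact ((DomAddAct.continuous_mk.comp continuous_neg)).vadd continuous_const
  refine h.congr fun r => ?_
  rw [L2.inner_def]
  refine integral_congr_ae ?_
  rw [DomAddAct.mk_vadd_toLp]
  filter_upwards [hg.coeFn_toLp, (hf.comp_measurePreserving
    (measurePreserving_vadd (-r) (volume : Measure ℝ))).coeFn_toLp] with s h1 h2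
  rw [h1]
  erw [h2]
  simp [Function.comp, sub_eq_neg_add]

/-- The integrand is that of the convolution of `g` with the reflection of `f`, hence integrable on
the product, and Fubini applies. -/
theorem integral_inner_translate_swap {V : Type*} [NormedAddCommGroup V]
    [InnerProductSpace ℝ V] {f g : ℝ → V} (hf : Integrable f) (hg : Integrable g) (h : ℝ) :
    (∫ r in (0 : ℝ)..h, ∫ s, inner ℝ (f (s - r)) (g s)) =
      ∫ s, ∫ r in (0 : ℝ)..h, inner ℝ (f (s - r)) (g s) := by
  refine intervalIntegral_integral_swap ?_
  have h1 := hg.convolution_integrand (innerSL ℝ) hf.comp_neg (μ := volume)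
  have h2 : Function.uncurry (fun r s : ℝ => inner ℝ (f (s - r)) (g s)) =
      fun p : ℝ × ℝ => innerSL ℝ (g p.2) (f (-(p.1 - p.2))) := by
    funext p
    simp [Function.uncurry, real_inner_comm]
  rw [h2]
  refine h1.mono_measure ?_
  exact Measure.prod_mono Measure.restrict_le_self le_rfl

theorem integrable_integral_inner_translate {V : Type*} [NormedAddCommGroup V]
    [InnerProductSpace ℝ V] {f g : ℝ → V} (hf : Integrable f) (hg : Integrable g) (h : ℝ)
    (hh : 0 ≤ h) :
    Integrable fun s => ∫ r in (0 : ℝ)..h, inner ℝ (f (s - r)) (g s) := by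
  have h1 := hg.convolution_integrand (innerSL ℝ) hf.comp_neg (μ := volume)
  have h2 : (fun p : ℝ × ℝ => innerSL ℝ (g p.2) (f (-(p.1 - p.2)))) =
    fun p : ℝ × ℝ => inner ℝ (f (p.2 - p.1)) (g p.2) := by
    funext p
    simp [real_inner_comm]
  rw [h2] at h1
  simp_rw [intervalIntegral.integral_of_le hh]
  exact (h1.mono_measure (Measure.prod_mono (Measure.restrict_le_self (s := Ioc 0 h))
    le_rfl)).integral_prod_right


/-! ### The energy inequality -/

theorem deriv_nonneg_of_nonneg_right {f : ℝ → ℝ} {f' : ℝ} (hf : HasDerivAt f f' 0) (h0 : f 0 = 0)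
    (h : ∀ x, 0 < x → 0 ≤ f x) : 0 ≤ f' := by
  refine ge_of_tendsto hf.tendsto_slope_zero_right ?_
  filter_upwards [self_mem_nhdsWithin] with x hx
  have hx' : 0 < x := hx
  simp only [zero_add, h0, sub_zero, smul_eq_mul]
  exact mul_nonneg (inv_nonneg.2 hx'.le) (h x hx')

/-- The weighted energy inequality for a function on the line that vanishes for negative times. -/
theorem energy_inequality_of_line {H V : Type*} [NormedAddCommGroup H] [InnerProductSpace ℝ H]
    [NormedAddCommGroup V] [InnerProductSpace ℝ V] (J : V →L[ℝ] H) {t K : ℝ} (ht : 0 ≤ t)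
    {u : ℝ → H} (hu : Continuous u) (hu0 : u 0 = 0) {U G : ℝ → V}
    (hU : MemLp U 2 (volume.restrict (Ioc 0 t)))
    (hUu : ∀ᵐ s ∂(volume.restrict (Ioc 0 t)), J (U s) = u s)
    (hG : MemLp G 2 volume) (hG1 : Integrable G)
    (heq : ∀ r s, r ≤ s → s ≤ t → ∀ w, inner ℝ (u s - u r) (J w) = ∫ q in r..s, inner ℝ (G q) w) :
    Real.exp (-2 * K * t) * ‖u t‖ ^ 2 + 2 * K * ∫ s in (0 : ℝ)..t, Real.exp (-2 * K * s) * ‖u s‖ ^ 2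
      ≤ 2 * ∫ s in (0 : ℝ)..t, Real.exp (-2 * K * s) * inner ℝ (G s) (U s) := by
  set θ : ℝ → ℝ := fun s => Real.exp (-2 * K * s) with hθ
  have hθc : Continuous θ := by fun_prop
  -- The weighted test function: cutting off to `(0, t]` lets integrals over this interval be taken
  -- over the whole line.
  set g : ℝ → V := (Ioc 0 t).indicator (fun s => θ s • U s) with hg
  have hθU : MemLp (fun s => θ s • U s) 2 (volume.restrict (Ioc 0 t)) := by
    obtain ⟨C, hC⟩ := (isCompact_Icc (a := (0 : ℝ)) (b := t)).exists_bound_of_continuousOn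
      hθc.continuousOn
    refine hU.of_le_mul (c := C) (hθc.aestronglyMeasurable.smul hU.1) ?_
    filter_upwards [ae_restrict_mem measurableSet_Ioc] with s hs
    rw [norm_smul]
    exact mul_le_mul_of_nonneg_right (hC s (Ioc_subset_Icc_self hs)) (norm_nonneg _)
  have hg2 : MemLp g 2 volume := (memLp_indicator_iff_restrict measurableSet_Ioc).2 hθU
  have hg1 : Integrable g := by
    rw [hg, integrable_indicator_iff measurableSet_Ioc]
    exact hθU.integrable (by norm_num)
  set c : ℝ → ℝ := fun r => ∫ s, inner ℝ (G (s - r)) (g s) with hc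
  have hcc : Continuous c := continuous_integral_inner_translate hG hg2
  set E : ℝ → ℝ := fun s => θ s * ‖u s‖ ^ 2 with hE
  have hEc : Continuous E := by fun_prop
  have hc0 : c 0 = ∫ s in (0 : ℝ)..t, θ s * inner ℝ (G s) (U s) := by
    rw [intervalIntegral.integral_of_le ht, ← integral_indicator measurableSet_Ioc]
    refine integral_congr_ae (Eventually.of_forall fun s => ?_)
    by_cases hs : s ∈ Ioc 0 t
    · simp [hg, hs, inner_smul_right]
    · simp [hg, hs]
  set Φ : ℝ → ℝ := fun x => ∫ s in (0 : ℝ)..x, E s with hΦ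
  have hΦd : ∀ x, HasDerivAt Φ (E x) x := fun x =>
    (hEc.integral_hasStrictDerivAt 0 x).hasDerivAt
  have hCd : HasDerivAt (fun x => ∫ s in (0 : ℝ)..x, c s) (c 0) 0 :=
    (hcc.integral_hasStrictDerivAt 0 0).hasDerivAt
  -- A closed form of `∫₀ᵗ θ(s)‖u(s - h)‖² ds`, differentiable in `h` because the shift has been
  -- moved to the limits of integration.
  set Ψ : ℝ → ℝ := fun h => Real.exp (-2 * K * h) * (Φ (t - h) - Φ (-h)) with hΨ
  have hE0 : E 0 = 0 := by simp [hE, hu0]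
  have hΨd : HasDerivAt Ψ (-2 * K * Φ t - E t) 0 := by
    have h1 : HasDerivAt (fun h : ℝ => Real.exp (-2 * K * h)) (-2 * K) 0 := by
      have := ((hasDerivAt_id (0 : ℝ)).const_mul (-2 * K)).exp
      simpa using this
    have h2 : HasDerivAt (fun h : ℝ => Φ (t - h)) (-E t) 0 := by
      have := (hΦd (t - 0)).comp_const_sub t 0
      simpa using this
    have h3 : HasDerivAt (fun h : ℝ => Φ (-h)) (-E 0) 0 := by
      have := (hΦd (0 - 0)).comp_const_sub 0 0
      simpa using this
    have h4 := h1.mul (h2.sub h3)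
    have h5 : Φ 0 = 0 := by simp [hΦ]
    refine (h4.congr_deriv ?_ : HasDerivAt Ψ _ 0)
    simp [hE0, h5]
    ring
  have hΨ0 : Ψ 0 = Φ t := by simp [hΨ, hΦ]
  -- The integrated difference inequality. It is an equality at `h = 0`, so its right derivative
  -- there is nonnegative, which is the claim.
  have hmain : ∀ h, 0 < h → 0 ≤ 2 * (∫ s in (0 : ℝ)..h, c s) + Ψ h - Φ t := by
    intro h hh
    have hΨh : Ψ h = ∫ s in (0 : ℝ)..t, θ s * ‖u (s - h)‖ ^ 2 := by
      have h1 : ∀ s, θ s * ‖u (s - h)‖ ^ 2 = Real.exp (-2 * K * h) * E (s - h) := by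
        intro s
        simp only [hE, hθ]
        rw [← mul_assoc, ← Real.exp_add]
        ring_nf
      simp_rw [h1]
      rw [intervalIntegral.integral_const_mul, intervalIntegral.integral_comp_sub_right E h, hΨ,
        hΦ]
      simp only
      rw [intervalIntegral.integral_interval_sub_left (hEc.intervalIntegrable _ _)
        (hEc.intervalIntegrable _ _), zero_sub]
    have hI := integrable_integral_inner_translate hG1 hg1 h hh.le
    rw [hc, integral_inner_translate_swap hG1 hg1 h, hΨh, hΦ]
    simp only
    have hae : ∀ᵐ s ∂(volume.restrict (Ioc 0 t)),
        E s - θ s * ‖u (s - h)‖ ^ 2 ≤ 2 * ∫ r in (0 : ℝ)..h, inner ℝ (G (s - r)) (g s) := by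
      filter_upwards [hUu, ae_restrict_mem measurableSet_Ioc] with s hs hst
      -- The equation on `[s - h, s]` tested with `θ(s) U(s)`, which `J` maps to `θ(s) u(s)`.
      have h1 : (∫ r in (0 : ℝ)..h, inner ℝ (G (s - r)) (g s)) =
          θ s * inner ℝ (u s - u (s - h)) (u s) := by
        rw [intervalIntegral.integral_comp_sub_left (fun q => inner ℝ (G q) (g s)) s, sub_zero,
          ← heq _ _ (by linarith) hst.2]
        simp [hg, hst, hs, inner_smul_right]
      rw [h1]
      -- The difference of the two sides is `‖u(s) - u(s - h)‖²`.
      have h2 : ‖u s‖ ^ 2 - ‖u (s - h)‖ ^ 2 ≤ 2 * inner ℝ (u s - u (s - h)) (u s) := by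
        have h3 := norm_sub_sq_real (u s) (u s - u (s - h))
        rw [sub_sub_cancel] at h3
        have h4 := sq_nonneg ‖u s - u (s - h)‖
        rw [real_inner_comm]
        linarith
      have h5 := mul_le_mul_of_nonneg_left h2 (Real.exp_pos (-2 * K * s)).le
      simp only [hE, hθ]
      linarith
    have hint1 : IntegrableOn (fun s => E s - θ s * ‖u (s - h)‖ ^ 2) (Ioc 0 t) := by
      have : Continuous fun s => E s - θ s * ‖u (s - h)‖ ^ 2 := by fun_prop
      exact (this.integrableOn_Icc).mono_set Ioc_subset_Icc_self
    have h3 := integral_mono_ae hint1 ((hI.integrableOn (s := Ioc 0 t)).const_mul 2) hae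
    rw [← intervalIntegral.integral_of_le ht, intervalIntegral.integral_sub
      (hEc.intervalIntegrable _ _) (Continuous.intervalIntegrable (by fun_prop) _ _),
      integral_const_mul] at h3
    have h4 : (∫ s in Ioc 0 t, ∫ r in (0 : ℝ)..h, inner ℝ (G (s - r)) (g s)) =
        ∫ s, ∫ r in (0 : ℝ)..h, inner ℝ (G (s - r)) (g s) := by
      refine setIntegral_eq_integral_of_forall_compl_eq_zero fun s hs => ?_
      simp [hg, hs]
    rw [h4] at h3
    linarith
  have hfin := deriv_nonneg_of_nonneg_right (((hCd.const_mul 2).add hΨd).sub_const (Φ t))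
    (by simp [hΨ0]) (fun x hx => by simpa using hmain x hx)
  rw [hc0] at hfin
  simp only [hE, hΦ, hθ] at hfin ⊢
  linarith

/-- The weighted energy inequality. -/
theorem energy_inequality {H V : Type*} [NormedAddCommGroup H] [InnerProductSpace ℝ H]
    [NormedAddCommGroup V] [InnerProductSpace ℝ V] (J : V →L[ℝ] H) {t K : ℝ} (ht : 0 ≤ t)
    {u : ℝ → H} (hu : ContinuousOn u (Icc 0 t)) (hu0 : u 0 = 0) {U G : ℝ → V}
    (hU : MemLp U 2 (volume.restrict (Ioc 0 t)))
    (hUu : ∀ᵐ s ∂(volume.restrict (Ioc 0 t)), J (U s) = u s)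
    (hG : MemLp G 2 (volume.restrict (Ioc 0 t)))
    (heq : ∀ s ∈ Icc 0 t, ∀ w, inner ℝ (u s) (J w) = ∫ q in (0 : ℝ)..s, inner ℝ (G q) w) :
    Real.exp (-2 * K * t) * ‖u t‖ ^ 2 + 2 * K * ∫ s in (0 : ℝ)..t, Real.exp (-2 * K * s) * ‖u s‖ ^ 2
      ≤ 2 * ∫ s in (0 : ℝ)..t, Real.exp (-2 * K * s) * inner ℝ (G s) (U s) := by
  -- Both functions are extended to the line: `u` by its endpoint values, hence by zero to the left,
  -- and `G` by zero. The equation then persists for all `s ≤ t`, as shifted arguments require.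
  set u' : ℝ → H := IccExtend ht ((Icc 0 t).domRestrict u) with hu'
  have hu'c : Continuous u' := hu.domRestrict.Icc_extend'
  have hu'e : ∀ s ∈ Icc 0 t, u' s = u s := fun s hs => by
    rw [hu', IccExtend_of_mem ht _ hs, domRestrict_apply]
  have hu'n : ∀ s ≤ 0, u' s = 0 := fun s hs => by
    rw [hu', IccExtend_of_le_left ht _ hs, domRestrict_apply, hu0]
  set G' : ℝ → V := (Ioc 0 t).indicator G with hG'
  have hG'2 : MemLp G' 2 volume := (memLp_indicator_iff_restrict measurableSet_Ioc).2 hG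
  have hG'1 : Integrable G' := by
    rw [hG', integrable_indicator_iff measurableSet_Ioc]
    exact hG.integrable (by norm_num)
  have hint : ∀ (w : V) (a b : ℝ), IntervalIntegrable (fun q => inner ℝ (G' q) w) volume a b :=
    fun w a b => (hG'1.inner_const w).intervalIntegrable
  have heq' : ∀ s ≤ t, ∀ w, inner ℝ (u' s) (J w) = ∫ q in (0 : ℝ)..s, inner ℝ (G' q) w := by
    intro s hs w
    rcases le_total s 0 with h0 | h0
    · rw [hu'n s h0, inner_zero_left, intervalIntegral.integral_of_ge h0]
      symm
      rw [neg_eq_zero]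
      refine setIntegral_eq_zero_of_forall_eq_zero fun q hq => ?_
      have : q ∉ Ioc 0 t := fun h => absurd hq.2 (not_le.2 h.1)
      simp [hG', this]
    · rw [hu'e s ⟨h0, hs⟩, heq s ⟨h0, hs⟩]
      refine intervalIntegral.integral_congr_ae (Eventually.of_forall fun q hq => ?_)
      rw [uIoc_of_le h0] at hq
      simp only [hG']
      have hq' : q ∈ Ioc 0 t := ⟨hq.1, hq.2.trans hs⟩
      rw [indicator_of_mem hq']
  have key := energy_inequality_of_line J (K := K) ht hu'c (hu'n 0 le_rfl) hU
    (by
      filter_upwards [hUu, ae_restrict_mem measurableSet_Ioc] with s h1 h2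
      rw [h1, hu'e s (Ioc_subset_Icc_self h2)]) hG'2 hG'1
    (fun r s hrs hst w => by
      rw [inner_sub_left, heq' s hst, heq' r (hrs.trans hst),
        intervalIntegral.integral_interval_sub_left (hint w _ _) (hint w _ _)])
  rw [hu'e t ⟨ht, le_rfl⟩] at key
  have e1 : (∫ s in (0 : ℝ)..t, Real.exp (-2 * K * s) * ‖u' s‖ ^ 2) =
      ∫ s in (0 : ℝ)..t, Real.exp (-2 * K * s) * ‖u s‖ ^ 2 := by
    refine intervalIntegral.integral_congr fun s hs => ?_
    rw [uIcc_of_le ht] at hs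
    simp only [hu'e s hs]
  have e2 : (∫ s in (0 : ℝ)..t, Real.exp (-2 * K * s) * inner ℝ (G' s) (U s)) =
      ∫ s in (0 : ℝ)..t, Real.exp (-2 * K * s) * inner ℝ (G s) (U s) := by
    refine intervalIntegral.integral_congr_ae (Eventually.of_forall fun q hq => ?_)
    rw [uIoc_of_le ht] at hq
    simp only [hG', indicator_of_mem hq]
  rwa [e1, e2] at key


/-! ### Multiplication operators between spaces of square-integrable functions -/

theorem exists_multiplication_operator {X F₁ F₂ : Type*} [MeasurableSpace X] {μ : Measure X}
    [NormedAddCommGroup F₁] [NormedSpace ℝ F₁] [NormedAddCommGroup F₂] [NormedSpace ℝ F₂]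
    (L : X → F₁ →ₗ[ℝ] F₂)
    (hL : ∀ G : Lp F₁ 2 μ, AEStronglyMeasurable (fun x => L x (G x)) μ) {C : ℝ} (hC0 : 0 ≤ C)
    (hC : ∀ᵐ x ∂μ, ∀ v, ‖L x v‖ ≤ C * ‖v‖) :
    ∃ S : Lp F₁ 2 μ →L[ℝ] Lp F₂ 2 μ, ‖S‖ ≤ C ∧ ∀ G, S G =ᵐ[μ] fun x => L x (G x) := by
  have hmem : ∀ G : Lp F₁ 2 μ, MemLp (fun x => L x (G x)) 2 μ := fun G =>
    (Lp.memLp G).of_le_mul (c := C) (hL G) (by filter_upwards [hC] with x hx using hx _)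
  let S₀ : Lp F₁ 2 μ →ₗ[ℝ] Lp F₂ 2 μ :=
    { toFun := fun G => (hmem G).toLp _
      map_add' := fun G G' => by
        rw [← MemLp.toLp_add, MemLp.toLp_eq_toLp_iff]
        filter_upwards [Lp.coeFn_add G G'] with x hx
        rw [hx]
        simp
      map_smul' := fun a G => by
        rw [RingHom.id_apply, ← MemLp.toLp_const_smul, MemLp.toLp_eq_toLp_iff]
        filter_upwards [Lp.coeFn_smul a G] with x hx
        rw [hx]
        simp }
  have hS₀ : ∀ G, S₀ G =ᵐ[μ] fun x => L x (G x) := fun G => (hmem G).coeFn_toLp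
  refine ⟨S₀.mkContinuous C fun G => ?_, S₀.mkContinuous_norm_le hC0 _, hS₀⟩
  refine Lp.norm_le_mul_norm_of_ae_le_mul ?_
  filter_upwards [hS₀ G, hC] with x h1 h2
  rw [h1]
  exact h2 _

theorem norm_toLp_mulVec_le {n : ℕ} (A : Matrix (Fin n) (Fin n) ℝ) (v : E n) :
    ‖WithLp.toLp 2 (A *ᵥ v.ofLp)‖ ≤ frobNorm A * ‖v‖ := by
  rw [EuclideanSpace.norm_eq, EuclideanSpace.norm_eq, frobNorm, ← Real.sqrt_mul (by positivity)]
  refine Real.sqrt_le_sqrt ?_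
  rw [Finset.sum_mul]
  refine Finset.sum_le_sum fun i _ => ?_
  simp only [Matrix.mulVec, dotProduct, Real.norm_eq_abs, sq_abs]
  exact Finset.sum_mul_sq_le_sq_mul_sq _ _ _

theorem dotProduct_eq_inner {n : ℕ} (v : E n) (w : Fin n → ℝ) :
    v.ofLp ⬝ᵥ w = inner ℝ v (WithLp.toLp 2 w) := by
  simp [PiLp.inner_apply, dotProduct, mul_comm]

theorem aestronglyMeasurable_mulVec {X : Type*} [MeasurableSpace X] {μ : Measure X} {n : ℕ}
    {A : X → Matrix (Fin n) (Fin n) ℝ} (hA : ∀ i j, AEStronglyMeasurable (fun x => A x i j) μ)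
    {G : X → E n} (hG : AEStronglyMeasurable G μ) :
    AEStronglyMeasurable (fun x => WithLp.toLp 2 (A x *ᵥ (G x).ofLp) : X → E n) μ := by
  refine (PiLp.continuous_toLp 2 _).comp_aestronglyMeasurable ?_
  refine AEMeasurable.aestronglyMeasurable (aemeasurable_pi_iff.2 fun i => ?_)
  simp only [Matrix.mulVec, dotProduct]
  refine Finset.aemeasurable_fun_sum _ fun j _ => ((hA i j).aemeasurable).mul ?_
  exact ((EuclideanSpace.proj (𝕜 := ℝ) j).continuous.comp_aestronglyMeasurable hG).aemeasurable

/-- The inverse is `det⁻¹` times the adjugate. With the convention `0⁻¹ = 0` this also holds for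
singular matrices, so no invertibility is needed. -/
theorem aemeasurable_matrix_inv {X : Type*} [MeasurableSpace X] {μ : Measure X} {n : ℕ}
    {A : X → Matrix (Fin n) (Fin n) ℝ} (hA : ∀ i j, AEMeasurable (fun x => A x i j) μ)
    (i j : Fin n) : AEMeasurable (fun x => (A x)⁻¹ i j) μ := by
  have hA' : AEMeasurable (fun x => (fun i j => A x i j : Fin n → Fin n → ℝ)) μ :=
    aemeasurable_pi_iff.2 fun i => aemeasurable_pi_iff.2 fun j => hA i j
  have h1 : Continuous fun M : Fin n → Fin n → ℝ => (Matrix.of M).det :=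
    Continuous.matrix_det (continuous_id)
  have h2 : Continuous fun M : Fin n → Fin n → ℝ => (Matrix.of M).adjugate i j :=
    (Continuous.matrix_adjugate (A := fun M : Fin n → Fin n → ℝ => Matrix.of M)
      continuous_id).matrix_elem i j
  have h3 := (h1.measurable.comp_aemeasurable hA').inv.mul (h2.measurable.comp_aemeasurable hA')
  refine h3.congr (Eventually.of_forall fun x => ?_)
  simp only [Matrix.inv_def, Matrix.smul_apply, smul_eq_mul, Ring.inverse_eq_inv']
  rfl

theorem exists_mulVec_operator {X : Type*} [MeasurableSpace X] {μ : Measure X} {n : ℕ}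
    {A : X → Matrix (Fin n) (Fin n) ℝ} (hA : ∀ i j, AEStronglyMeasurable (fun x => A x i j) μ)
    {C : ℝ} (hC0 : 0 ≤ C) (hC : ∀ᵐ x ∂μ, frobNorm (A x) ≤ C) :
    ∃ S : Lp (E n) 2 μ →L[ℝ] Lp (E n) 2 μ, ‖S‖ ≤ C ∧
      ∀ G, S G =ᵐ[μ] fun x => WithLp.toLp 2 (A x *ᵥ (G x).ofLp) :=
  exists_multiplication_operator
    (fun x => (WithLp.linearEquiv 2 ℝ (Fin n → ℝ)).symm.toLinearMap ∘ₗ (A x).mulVecLin ∘ₗ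
      (WithLp.linearEquiv 2 ℝ (Fin n → ℝ)).toLinearMap)
    (fun G => aestronglyMeasurable_mulVec hA (Lp.aestronglyMeasurable G)) hC0
    (hC.mono fun x hx v => (norm_toLp_mulVec_le (A x) v).trans
      (mul_le_mul_of_nonneg_right hx (norm_nonneg v)))

theorem exists_inner_operator {X V : Type*} [MeasurableSpace X] {μ : Measure X}
    [NormedAddCommGroup V] [InnerProductSpace ℝ V] {f : X → V} (hf : AEStronglyMeasurable f μ)
    {C : ℝ} (hC0 : 0 ≤ C) (hC : ∀ᵐ x ∂μ, ‖f x‖ ≤ C) :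
    ∃ S : Lp V 2 μ →L[ℝ] Lp ℝ 2 μ, ‖S‖ ≤ C ∧ ∀ G, S G =ᵐ[μ] fun x => inner ℝ (f x) (G x) :=
  exists_multiplication_operator (fun x => (innerSL ℝ (f x)).toLinearMap)
    (fun G => hf.inner (𝕜 := ℝ) (Lp.aestronglyMeasurable G)) hC0
    (hC.mono fun x hx v => (norm_inner_le_norm (𝕜 := ℝ) (f x) v).trans
      (mul_le_mul_of_nonneg_right hx (norm_nonneg v)))

theorem exists_mul_operator {X : Type*} [MeasurableSpace X] {μ : Measure X} {a : X → ℝ}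
    (ha : AEStronglyMeasurable a μ) {C : ℝ} (hC0 : 0 ≤ C) (hC : ∀ᵐ x ∂μ, |a x| ≤ C) :
    ∃ S : Lp ℝ 2 μ →L[ℝ] Lp ℝ 2 μ, ‖S‖ ≤ C ∧ ∀ v, S v =ᵐ[μ] fun x => a x * v x :=
  exists_multiplication_operator (fun x => LinearMap.mulLeft ℝ (a x))
    (fun v => ha.mul (Lp.aestronglyMeasurable v)) hC0
    (hC.mono fun x hx v => (norm_mul_le (a x) v).trans
      (mul_le_mul_of_nonneg_right hx (norm_nonneg v)))

/-! ### The time slices of the coefficients -/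

theorem volume_restrict_cylinder {n : ℕ} (D : Set (E n)) (T : ℝ) :
    (volume : Measure (E n × ℝ)).restrict (cylinder D T) =
      (spaceMeasure D).prod (timeMeasure T) := by
  rw [timeMeasure, ← Measure.restrict_congr_set (Ioo_ae_eq_Icc (μ := volume)), Measure.prod_restrict,
    ← Measure.volume_eq_prod]
  rfl

theorem ae_ae_slice {n : ℕ} {D : Set (E n)} {T : ℝ} {p : E n × ℝ → Prop}
    (h : ∀ᵐ q ∂((volume : Measure (E n × ℝ)).restrict (cylinder D T)), p q) :
    ∀ᵐ s ∂(timeMeasure T), ∀ᵐ x ∂(spaceMeasure D), p (x, s) := by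
  rw [volume_restrict_cylinder] at h
  exact Measure.ae_ae_of_ae_prod
    ((Measure.measurePreserving_swap (μ := timeMeasure T)).quasiMeasurePreserving.ae h)

theorem ae_aestronglyMeasurable_slice {n : ℕ} {D : Set (E n)} {T : ℝ} {β : Type*}
    [TopologicalSpace β] {g : E n × ℝ → β}
    (h : AEStronglyMeasurable g ((volume : Measure (E n × ℝ)).restrict (cylinder D T))) :
    ∀ᵐ s ∂(timeMeasure T), AEStronglyMeasurable (fun x => g (x, s)) (spaceMeasure D) := by
  rw [volume_restrict_cylinder] at h
  exact h.prod_swap.prodMk_left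

theorem aestronglyMeasurable_integral_slice {n : ℕ} {D : Set (E n)} {T : ℝ} {g : E n × ℝ → ℝ}
    (h : AEStronglyMeasurable g ((spaceMeasure D).prod (timeMeasure T))) :
    AEStronglyMeasurable (fun s => ∫ x in D, g (x, s)) (timeMeasure T) :=
  h.prod_swap.integral_prod_right'

/-- Multiplication by the coefficients at a fixed time, as operators on square-integrable
functions. -/
structure SliceOperators {n : ℕ} (c : Coefficients n) (D : Set (E n)) (s : ℝ) where
  b : H0Vec D →L[ℝ] H0Vec D
  binv : H0Vec D →L[ℝ] H0Vec D
  f : H0Vec D →L[ℝ] H0 D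
  lam : H0 D →L[ℝ] H0 D
  b_apply : ∀ G, b G =ᵐ[spaceMeasure D] fun x => WithLp.toLp 2 (c.b x s *ᵥ (G x).ofLp)
  binv_apply : ∀ G, binv G =ᵐ[spaceMeasure D] fun x => WithLp.toLp 2 ((c.b x s)⁻¹ *ᵥ (G x).ofLp)
  f_apply : ∀ G, f G =ᵐ[spaceMeasure D] fun x => inner ℝ (c.f x s) (G x)
  lam_apply : ∀ v, lam v =ᵐ[spaceMeasure D] fun x => c.lam x s * v x

theorem frobNorm_nonneg {n : ℕ} (A : Matrix (Fin n) (Fin n) ℝ) : 0 ≤ frobNorm A :=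
  Real.sqrt_nonneg _

/-- At almost every time the integrals in `form` and `invForm` become `L²` inner products, so their
integrability and bilinearity come for free. The bound `C` is uniform in time. -/
theorem Coefficients.IsAdmissible.exists_sliceOperators {n : ℕ} {c : Coefficients n}
    {D : Set (E n)} {T δ : ℝ} (hc : c.IsAdmissible D T δ) :
    ∃ C : ℝ, 0 ≤ C ∧ ∀ᵐ s ∂(timeMeasure T), ∃ S : SliceOperators c D s,
      ‖S.b‖ ≤ C ∧ ‖S.binv‖ ≤ C ∧ ‖S.f‖ ≤ C ∧ ‖S.lam‖ ≤ C := by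
  obtain ⟨C, hC⟩ := hc.bounded
  -- The given essential bound may be negative when `Q` is null.
  refine ⟨max C 0, le_max_right _ _, ?_⟩
  have hb : ∀ᵐ s ∂(timeMeasure T), ∀ i j,
      AEStronglyMeasurable (fun x => c.b x s i j) (spaceMeasure D) :=
    ae_all_iff.2 fun i => ae_all_iff.2 fun j =>
      ae_aestronglyMeasurable_slice (g := fun p => c.b p.1 p.2 i j)
        (hc.measurable_b i j).aestronglyMeasurable
  have hi : ∀ᵐ s ∂(timeMeasure T), ∀ i j,
      AEStronglyMeasurable (fun x => (c.b x s)⁻¹ i j) (spaceMeasure D) :=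
    ae_all_iff.2 fun i => ae_all_iff.2 fun j =>
      ae_aestronglyMeasurable_slice (g := fun p => (c.b p.1 p.2)⁻¹ i j)
        (aemeasurable_matrix_inv (A := fun p : E n × ℝ => c.b p.1 p.2) hc.measurable_b i j).aestronglyMeasurable
  have hf : ∀ᵐ s ∂(timeMeasure T), AEStronglyMeasurable (fun x => c.f x s) (spaceMeasure D) :=
    ae_aestronglyMeasurable_slice (g := fun p => c.f p.1 p.2)
      hc.measurable_f.aestronglyMeasurable
  have hl : ∀ᵐ s ∂(timeMeasure T), AEStronglyMeasurable (fun x => c.lam x s) (spaceMeasure D) :=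
    ae_aestronglyMeasurable_slice (g := fun p => c.lam p.1 p.2)
      hc.measurable_lam.aestronglyMeasurable
  have hC' : ∀ᵐ s ∂(timeMeasure T), ∀ᵐ x ∂(spaceMeasure D), frobNorm (c.b x s) +
      frobNorm (c.b x s)⁻¹ + ‖c.f x s‖ + |c.lam x s| ≤ max C 0 :=
    ae_ae_slice (p := fun p => frobNorm (c.b p.1 p.2) + frobNorm (c.b p.1 p.2)⁻¹ +
      ‖c.f p.1 p.2‖ + |c.lam p.1 p.2| ≤ max C 0)
      (hC.mono fun p hp => hp.trans (le_max_left C 0))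
  filter_upwards [hb, hi, hf, hl, hC'] with s hb hi hf hl hC
  have h0 : 0 ≤ max C 0 := le_max_right _ _
  obtain ⟨Sb, hSb, hSb'⟩ := exists_mulVec_operator (A := fun x => c.b x s) hb h0 (hC.mono fun x hx => by
    linarith [frobNorm_nonneg (c.b x s)⁻¹, norm_nonneg (c.f x s), abs_nonneg (c.lam x s)])
  obtain ⟨Si, hSi, hSi'⟩ := exists_mulVec_operator (A := fun x => (c.b x s)⁻¹) hi h0 (hC.mono fun x hx => by
    linarith [frobNorm_nonneg (c.b x s), norm_nonneg (c.f x s), abs_nonneg (c.lam x s)])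
  obtain ⟨Sf, hSf, hSf'⟩ := exists_inner_operator hf h0 (hC.mono fun x hx => by
    linarith [frobNorm_nonneg (c.b x s), frobNorm_nonneg (c.b x s)⁻¹, abs_nonneg (c.lam x s)])
  obtain ⟨Sl, hSl, hSl'⟩ := exists_mul_operator hl h0 (hC.mono fun x hx => by
    linarith [frobNorm_nonneg (c.b x s), frobNorm_nonneg (c.b x s)⁻¹, norm_nonneg (c.f x s)])
  exact ⟨⟨Sb, Si, Sf, Sl, hSb', hSi', hSf', hSl'⟩, hSb, hSi, hSf, hSl⟩

theorem SliceOperators.form_eq {n : ℕ} {c : Coefficients n} {D : Set (E n)} {s : ℝ}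
    (S : SliceOperators c D s) (v w : H1 D) :
    c.form s v w = -inner ℝ (S.b v.grad) w.grad + inner ℝ (S.f v.grad) w.val
      + inner ℝ (S.lam v.val) w.val := by
  rw [L2.inner_def, L2.inner_def, L2.inner_def, Coefficients.form]
  congr 1
  · congr 1
    · congr 1
      refine integral_congr_ae ?_
      filter_upwards [S.b_apply v.grad] with x hx
      rw [hx, dotProduct_eq_inner, real_inner_comm]
    · refine integral_congr_ae ?_
      filter_upwards [S.f_apply v.grad] with x hx
      rw [hx]
      simp [mul_comm]
  · refine integral_congr_ae ?_
    filter_upwards [S.lam_apply v.val] with x hx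
    rw [hx]
    simp [mul_comm]

theorem SliceOperators.invForm_eq {n : ℕ} {c : Coefficients n} {D : Set (E n)} {s : ℝ}
    (S : SliceOperators c D s) (F : H0Vec D) :
    c.invForm s F = inner ℝ (S.binv F) F := by
  rw [L2.inner_def, Coefficients.invForm]
  refine integral_congr_ae ?_
  filter_upwards [S.binv_apply F] with x hx
  rw [hx, dotProduct_eq_inner, real_inner_comm]


/-! ### Separability -/

theorem secondCountableTopology_Lp_two {n : ℕ} (D : Set (E n)) (F : Type*) [NormedAddCommGroup F]
    [TopologicalSpace.SeparableSpace F] : SecondCountableTopology (Lp F 2 (spaceMeasure D)) := by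
  have : Fact ((2 : ℝ≥0∞) ≠ ⊤) := ⟨by norm_num⟩
  infer_instance

theorem separableSpace_H0Vec {n : ℕ} (D : Set (E n)) :
    TopologicalSpace.SeparableSpace (H0Vec D) := by
  have := secondCountableTopology_Lp_two D (E n)
  infer_instance

theorem separableSpace_H1 {n : ℕ} (D : Set (E n)) :
    TopologicalSpace.SeparableSpace (H1 D) := by
  have h1 := secondCountableTopology_Lp_two D (E n)
  have h2 := secondCountableTopology_Lp_two D ℝ
  have h3 : SecondCountableTopology (WithLp 2 (H0 D × H0Vec D)) :=
    (WithLp.homeomorphProd 2 (H0 D) (H0Vec D)).secondCountableTopology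
  have h4 : SecondCountableTopology (H1 D) :=
    TopologicalSpace.Subtype.secondCountableTopology _
  infer_instance

/-! ### The function and the gradient as operators on `H¹` -/

/-- The embedding of `H¹` into `H⁰`. -/
noncomputable def H1.valL {n : ℕ} (D : Set (E n)) : H1 D →L[ℝ] H0 D :=
  (WithLp.fstL 2 ℝ (H0 D) (H0Vec D)).comp (testGraph D).topologicalClosure.subtypeL

/-- The gradient as an operator on `H¹`. -/
noncomputable def H1.gradL {n : ℕ} (D : Set (E n)) : H1 D →L[ℝ] H0Vec D :=
  (WithLp.sndL 2 ℝ (H0 D) (H0Vec D)).comp (testGraph D).topologicalClosure.subtypeL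

@[simp] theorem H1.valL_apply {n : ℕ} {D : Set (E n)} (v : H1 D) : H1.valL D v = v.val := rfl

theorem H1.norm_sq {n : ℕ} {D : Set (E n)} (v : H1 D) :
    ‖v‖ ^ 2 = ‖v.val‖ ^ 2 + ‖v.grad‖ ^ 2 :=
  WithLp.prod_norm_sq_eq_of_L2 (v : WithLp 2 (H0 D × H0Vec D))

theorem H1.norm_val_le {n : ℕ} {D : Set (E n)} (v : H1 D) : ‖v.val‖ ≤ ‖v‖ := by
  refine abs_le_of_sq_le_sq' ?_ (norm_nonneg v) |>.2
  rw [H1.norm_sq]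
  linarith [sq_nonneg ‖v.grad‖]

theorem H1.norm_grad_le {n : ℕ} {D : Set (E n)} (v : H1 D) : ‖v.grad‖ ≤ ‖v‖ := by
  refine abs_le_of_sq_le_sq' ?_ (norm_nonneg v) |>.2
  rw [H1.norm_sq]
  linarith [sq_nonneg ‖v.val‖]

/-! ### The bilinear forms -/

/-- The bilinear form of `𝒜` at a fixed time. -/
noncomputable def SliceOperators.bilin {n : ℕ} {c : Coefficients n} {D : Set (E n)} {s : ℝ}
    (S : SliceOperators c D s) : H1 D →L[ℝ] H1 D →L[ℝ] ℝ :=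
  -((innerSL ℝ).bilinearComp (S.b.comp (H1.gradL D)) (H1.gradL D))
    + (innerSL ℝ).bilinearComp (S.f.comp (H1.gradL D)) (H1.valL D)
    + (innerSL ℝ).bilinearComp (S.lam.comp (H1.valL D)) (H1.valL D)

theorem SliceOperators.bilin_apply {n : ℕ} {c : Coefficients n} {D : Set (E n)} {s : ℝ}
    (S : SliceOperators c D s) (v w : H1 D) : S.bilin v w = c.form s v w := by
  rw [S.form_eq]
  rfl

theorem abs_inner_apply_le {A B : Type*} [NormedAddCommGroup A] [NormedSpace ℝ A]
    [NormedAddCommGroup B] [InnerProductSpace ℝ B] (S : A →L[ℝ] B) {C a b : ℝ} (hC : 0 ≤ C)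
    (hS : ‖S‖ ≤ C) {x : A} {y : B} (hx : ‖x‖ ≤ a) (hy : ‖y‖ ≤ b) :
    |inner ℝ (S x) y| ≤ C * a * b := by
  have ha : 0 ≤ a := (norm_nonneg x).trans hx
  calc |inner ℝ (S x) y| ≤ ‖S x‖ * ‖y‖ := abs_real_inner_le_norm _ _
    _ ≤ (C * a) * b := by
        gcongr
        exact (S.le_of_opNorm_le hS x).trans (by gcongr)

theorem SliceOperators.abs_form_le {n : ℕ} {c : Coefficients n} {D : Set (E n)} {s : ℝ}
    (S : SliceOperators c D s) {C : ℝ} (hC : 0 ≤ C) (hb : ‖S.b‖ ≤ C) (hf : ‖S.f‖ ≤ C)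
    (hl : ‖S.lam‖ ≤ C) (v w : H1 D) : |c.form s v w| ≤ 3 * C * ‖v‖ * ‖w‖ := by
  rw [S.form_eq]
  have h1 := abs_le.1 (abs_inner_apply_le S.b hC hb v.norm_grad_le w.norm_grad_le)
  have h2 := abs_le.1 (abs_inner_apply_le S.f hC hf v.norm_grad_le w.norm_val_le)
  have h3 := abs_le.1 (abs_inner_apply_le S.lam hC hl v.norm_val_le w.norm_val_le)
  rw [abs_le]
  constructor <;> linarith [h1.1, h1.2, h2.1, h2.2, h3.1, h3.2]

/-- The bilinear form of `b⁻¹` at a fixed time. -/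
noncomputable def SliceOperators.invBilin {n : ℕ} {c : Coefficients n} {D : Set (E n)} {s : ℝ}
    (S : SliceOperators c D s) : H0Vec D →L[ℝ] H0Vec D →L[ℝ] ℝ :=
  (innerSL ℝ).comp S.binv

theorem SliceOperators.invBilin_apply {n : ℕ} {c : Coefficients n} {D : Set (E n)} {s : ℝ}
    (S : SliceOperators c D s) (F G : H0Vec D) :
    S.invBilin F G = ∫ x in D, (G x).ofLp ⬝ᵥ ((c.b x s)⁻¹ *ᵥ (F x).ofLp) := by
  change inner ℝ (S.binv F) G = _
  rw [L2.inner_def]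
  refine integral_congr_ae ?_
  filter_upwards [S.binv_apply F] with x hx
  rw [hx, dotProduct_eq_inner, real_inner_comm]

theorem aestronglyMeasurable_dotProduct_mulVec {X : Type*} [MeasurableSpace X] {μ : Measure X}
    {n : ℕ} {A : X → Matrix (Fin n) (Fin n) ℝ}
    (hA : ∀ i j, AEStronglyMeasurable (fun x => A x i j) μ) {F G : X → E n}
    (hF : AEStronglyMeasurable F μ) (hG : AEStronglyMeasurable G μ) :
    AEStronglyMeasurable (fun x => (F x).ofLp ⬝ᵥ (A x *ᵥ (G x).ofLp)) μ := by
  simp_rw [dotProduct_eq_inner]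
  exact hF.inner (𝕜 := ℝ) (aestronglyMeasurable_mulVec hA hG)

theorem Coefficients.IsAdmissible.aestronglyMeasurable_form {n : ℕ} {c : Coefficients n}
    {D : Set (E n)} {T δ : ℝ} (hc : c.IsAdmissible D T δ) (v w : H1 D) :
    AEStronglyMeasurable (fun s => c.form s v w) (timeMeasure T) := by
  have hb := hc.measurable_b
  have hf := hc.measurable_f
  have hl := hc.measurable_lam
  rw [volume_restrict_cylinder] at hb hf hl
  have gv : AEStronglyMeasurable (fun p : E n × ℝ => v.grad p.1)
    ((spaceMeasure D).prod (timeMeasure T)) := (Lp.aestronglyMeasurable v.grad).comp_fst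
  have gw : AEStronglyMeasurable (fun p : E n × ℝ => w.grad p.1)
    ((spaceMeasure D).prod (timeMeasure T)) := (Lp.aestronglyMeasurable w.grad).comp_fst
  have fv : AEStronglyMeasurable (fun p : E n × ℝ => v.val p.1)
    ((spaceMeasure D).prod (timeMeasure T)) := (Lp.aestronglyMeasurable v.val).comp_fst
  have fw : AEStronglyMeasurable (fun p : E n × ℝ => w.val p.1)
    ((spaceMeasure D).prod (timeMeasure T)) := (Lp.aestronglyMeasurable w.val).comp_fst
  have h1 := aestronglyMeasurable_integral_slice
    (aestronglyMeasurable_dotProduct_mulVec (A := fun p : E n × ℝ => c.b p.1 p.2)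
      (fun i j => (hb i j).aestronglyMeasurable) gw gv)
  have h2 := aestronglyMeasurable_integral_slice
    ((hf.aestronglyMeasurable.inner (𝕜 := ℝ) gv).mul fw)
  have h3 := aestronglyMeasurable_integral_slice ((hl.aestronglyMeasurable.mul fv).mul fw)
  exact (h1.neg.add h2).add h3

theorem Coefficients.IsAdmissible.aestronglyMeasurable_inv {n : ℕ} {c : Coefficients n}
    {D : Set (E n)} {T δ : ℝ} (hc : c.IsAdmissible D T δ) (F G : H0Vec D) :
    AEStronglyMeasurable (fun s => ∫ x in D, (G x).ofLp ⬝ᵥ ((c.b x s)⁻¹ *ᵥ (F x).ofLp))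
      (timeMeasure T) := by
  have hb := hc.measurable_b
  rw [volume_restrict_cylinder] at hb
  refine aestronglyMeasurable_integral_slice (g := fun p : E n × ℝ =>
    (G p.1).ofLp ⬝ᵥ ((c.b p.1 p.2)⁻¹ *ᵥ (F p.1).ofLp)) ?_
  exact aestronglyMeasurable_dotProduct_mulVec (A := fun p : E n × ℝ => (c.b p.1 p.2)⁻¹)
      (fun i j => (aemeasurable_matrix_inv (A := fun p : E n × ℝ => c.b p.1 p.2)
        hb i j).aestronglyMeasurable) (Lp.aestronglyMeasurable G).comp_fst
        (Lp.aestronglyMeasurable F).comp_fst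

/-- The functionals `𝒜(s) U(s)`, represented by elements of `H¹`. -/
theorem Coefficients.IsAdmissible.exists_form_representative {n : ℕ} {c : Coefficients n}
    {D : Set (E n)} {T δ : ℝ} (hc : c.IsAdmissible D T δ) (U : X1 D T) :
    ∃ G : ℝ → H1 D, MemLp G 2 (timeMeasure T) ∧
      ∀ᵐ s ∂(timeMeasure T), ∀ w, inner ℝ (G s) w = c.form s (U s) w := by
  obtain ⟨C, hC, h⟩ := hc.exists_sliceOperators
  have := separableSpace_H1 D
  refine exists_memLp_two_inner_eq (a := fun s v w => c.form s v w) (C := 3 * C) ?_ ?_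
    hc.aestronglyMeasurable_form (Lp.memLp U)
  · filter_upwards [h] with s ⟨S, _⟩ using ⟨S.bilin, S.bilin_apply⟩
  · filter_upwards [h] with s ⟨S, h1, h2, h3, h4⟩ using S.abs_form_le hC h1 h3 h4

theorem Coefficients.IsAdmissible.integrable_invForm {n : ℕ} {c : Coefficients n}
    {D : Set (E n)} {T δ : ℝ} (hc : c.IsAdmissible D T δ) (F : X0Vec D T) :
    Integrable (fun s => c.invForm s (F s)) (timeMeasure T) := by
  obtain ⟨C, hC, h⟩ := hc.exists_sliceOperators
  have := separableSpace_H0Vec D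
  obtain ⟨G, hG, hGe⟩ := exists_memLp_two_inner_eq (a := fun s (F G : H0Vec D) =>
    ∫ x in D, (G x).ofLp ⬝ᵥ ((c.b x s)⁻¹ *ᵥ (F x).ofLp)) (C := C) (by
      filter_upwards [h] with s ⟨S, _⟩ using ⟨S.invBilin, S.invBilin_apply⟩) (by
      filter_upwards [h] with s ⟨S, _, h2, _⟩ F G
      rw [← S.invBilin_apply]
      exact abs_inner_apply_le S.binv hC h2 le_rfl le_rfl)
    hc.aestronglyMeasurable_inv (Lp.memLp F)
  refine (memLp_two_inner_integrable hG (Lp.memLp F)).congr ?_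
  filter_upwards [hGe] with s hs using hs (F s)

/-! ### The pointwise estimate -/

theorem isUnit_of_coercive {n : ℕ} {A : Matrix (Fin n) (Fin n) ℝ} {δ : ℝ} (hδ : 0 < δ)
    (hA : ∀ ξ : E n, δ * ‖ξ‖ ^ 2 ≤ ξ.ofLp ⬝ᵥ (A *ᵥ ξ.ofLp)) : IsUnit A := by
  rw [← Matrix.mulVec_injective_iff_isUnit]
  have h : ∀ v, A *ᵥ v = 0 → v = 0 := by
    intro v hv
    have h1 := hA (WithLp.toLp 2 v)
    simp only [hv, dotProduct_zero] at h1
    have h2 : ‖WithLp.toLp 2 v‖ ^ 2 ≤ 0 := by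
      by_contra hcon
      have := mul_pos hδ (not_le.1 hcon)
      linarith
    have h3 : WithLp.toLp 2 v = 0 := by
      rw [← norm_eq_zero]
      exact pow_eq_zero_iff (two_ne_zero) |>.1 (le_antisymm h2 (sq_nonneg _))
    simpa using h3
  intro v w hvw
  have := h (v - w) (by rw [Matrix.mulVec_sub]; exact sub_eq_zero.2 hvw)
  exact sub_eq_zero.1 this

theorem dotProduct_mulVec_inv_nonneg {n : ℕ} {A : Matrix (Fin n) (Fin n) ℝ} {δ : ℝ} (hδ : 0 < δ)
    (hA : ∀ ξ : E n, δ * ‖ξ‖ ^ 2 ≤ ξ.ofLp ⬝ᵥ (A *ᵥ ξ.ofLp)) (v : Fin n → ℝ) :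
    0 ≤ v ⬝ᵥ (A⁻¹ *ᵥ v) := by
  have hu : IsUnit A.det := (Matrix.isUnit_iff_isUnit_det A).1 (isUnit_of_coercive hδ hA)
  have h1 := hA (WithLp.toLp 2 (A⁻¹ *ᵥ v))
  simp only [Matrix.mulVec_mulVec, Matrix.mul_nonsing_inv A hu, Matrix.one_mulVec] at h1
  rw [dotProduct_comm]
  exact (by positivity : 0 ≤ δ * _).trans h1

/-- Young's inequality for a symmetric positive matrix. -/
theorem neg_dotProduct_le {n : ℕ} {A : Matrix (Fin n) (Fin n) ℝ} {δ : ℝ} (hδ : 0 < δ)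
    (hsymm : A.IsSymm) (hA : ∀ ξ : E n, δ * ‖ξ‖ ^ 2 ≤ ξ.ofLp ⬝ᵥ (A *ᵥ ξ.ofLp)) {m : ℝ} (hm : 0 < m)
    (ξ v : Fin n → ℝ) :
    -(2 * (v ⬝ᵥ ξ)) ≤ m⁻¹ * (ξ ⬝ᵥ (A *ᵥ ξ)) + m * (v ⬝ᵥ (A⁻¹ *ᵥ v)) := by
  have hu : IsUnit A.det := (Matrix.isUnit_iff_isUnit_det A).1 (isUnit_of_coercive hδ hA)
  -- With `v = Aζ` the claim is nonnegativity of `m⁻¹ (ξ + mζ)·A(ξ + mζ)`; symmetry of `A` merges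
  -- the two cross terms.
  obtain ⟨ζ, rfl⟩ : ∃ ζ, v = A *ᵥ ζ := ⟨A⁻¹ *ᵥ v, by
    rw [Matrix.mulVec_mulVec, Matrix.mul_nonsing_inv A hu, Matrix.one_mulVec]⟩
  have h0 : A⁻¹ *ᵥ (A *ᵥ ζ) = ζ := by
    rw [Matrix.mulVec_mulVec, Matrix.nonsing_inv_mul A hu, Matrix.one_mulVec]
  have hsw : ξ ⬝ᵥ (A *ᵥ ζ) = ζ ⬝ᵥ (A *ᵥ ξ) := by
    rw [Matrix.dotProduct_mulVec, ← Matrix.mulVec_transpose, hsymm.eq, dotProduct_comm]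
  have h1 := hA (WithLp.toLp 2 (ξ + m • ζ))
  have h2 : 0 ≤ (ξ + m • ζ) ⬝ᵥ (A *ᵥ (ξ + m • ζ)) := (by positivity : 0 ≤ δ * _).trans h1
  simp only [Matrix.mulVec_add, Matrix.mulVec_smul, add_dotProduct, dotProduct_add,
    smul_dotProduct, dotProduct_smul, smul_eq_mul] at h2
  rw [h0, dotProduct_comm (A *ᵥ ζ) ξ, dotProduct_comm (A *ᵥ ζ) ζ]
  have h3 := mul_nonneg (inv_nonneg.2 hm.le) h2
  have h4 : m⁻¹ * (ξ ⬝ᵥ A *ᵥ ξ + m * ζ ⬝ᵥ A *ᵥ ξ + m * (ξ ⬝ᵥ A *ᵥ ζ + m * ζ ⬝ᵥ A *ᵥ ζ)) =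
      m⁻¹ * ξ ⬝ᵥ A *ᵥ ξ + ζ ⬝ᵥ A *ᵥ ξ + ξ ⬝ᵥ A *ᵥ ζ + m * ζ ⬝ᵥ A *ᵥ ζ := by
    field_simp
    ring
  rw [h4] at h3
  linarith

/-- The constant in front of `‖v‖²` in the energy estimate. -/
noncomputable def energyConstant (δ Λ e : ℝ) : ℝ :=
  Λ ^ 2 / (2 * δ * (1 - (1 + 2 * e)⁻¹)) + 2 * |Λ| + e⁻¹

theorem energyConstant_nonneg {δ Λ e : ℝ} (hδ : 0 < δ) (he : 0 < e) :
    0 ≤ energyConstant δ Λ e := by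
  have : (1 + 2 * e)⁻¹ < 1 := inv_lt_one_of_one_lt₀ (by linarith)
  have : 0 < 1 - (1 + 2 * e)⁻¹ := by linarith
  unfold energyConstant
  positivity

/-- Young's inequality with weight `1/2 + e` on `F·b⁻¹F` costs `2q` times `ξ·Aξ`, where `q = 1/(1 +
2e) < 1`. Of the available `2 ξ·Aξ` there remains `2(1 - q) ξ·Aξ ≥ d‖ξ‖²`, which absorbs the drift.
This is why `1/2` is the limiting constant here. -/
theorem pointwise_energy_estimate {n : ℕ} {A : Matrix (Fin n) (Fin n) ℝ} {δ Λ e l y z : ℝ}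
    (hδ : 0 < δ) (he : 0 < e) (hsymm : A.IsSymm)
    (hA : ∀ ξ : E n, δ * ‖ξ‖ ^ 2 ≤ ξ.ofLp ⬝ᵥ (A *ᵥ ξ.ofLp)) {f ξ F : E n} (hf : ‖f‖ ≤ Λ)
    (hl : |l| ≤ Λ) :
    2 * (-(ξ.ofLp ⬝ᵥ (A *ᵥ ξ.ofLp)) + inner ℝ f ξ * y + l * y * y - inner ℝ F ξ + z * y) ≤
      (1 / 2 + e) * (F.ofLp ⬝ᵥ (A⁻¹ *ᵥ F.ofLp)) + e * z ^ 2 + energyConstant δ Λ e * y ^ 2 := by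
  set q := (1 + 2 * e)⁻¹ with hq
  have hq1 : q < 1 := inv_lt_one_of_one_lt₀ (by linarith)
  have h1 := neg_dotProduct_le hδ hsymm hA (m := 1 / 2 + e) (by linarith) ξ.ofLp F.ofLp
  have hm : (1 / 2 + e)⁻¹ = 2 * q := by
    rw [hq, show 1 / 2 + e = (1 + 2 * e) / 2 by ring, inv_div, div_eq_mul_inv]
  have hF : F.ofLp ⬝ᵥ ξ.ofLp = inner ℝ F ξ := by rw [dotProduct_eq_inner]
  rw [hF, hm] at h1
  have h2 := mul_le_mul_of_nonneg_left (hA ξ) (by linarith : 0 ≤ 2 * (1 - q))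
  have h3 : inner ℝ f ξ * y ≤ Λ * ‖ξ‖ * |y| := by
    calc inner ℝ f ξ * y ≤ |inner ℝ f ξ * y| := le_abs_self _
      _ = |inner ℝ f ξ| * |y| := abs_mul _ _
      _ ≤ (‖f‖ * ‖ξ‖) * |y| := by gcongr; exact abs_real_inner_le_norm _ _
      _ ≤ _ := by gcongr
  set d := 2 * δ * (1 - q) with hd
  have hdpos : 0 < d := by have : 0 < 1 - q := by linarith
                           positivity
  have h4 : 2 * (Λ * ‖ξ‖ * |y|) ≤ d * ‖ξ‖ ^ 2 + Λ ^ 2 / d * y ^ 2 := by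
    -- Completing the square with weight `d` makes the gradient part of the drift cancel exactly
    -- against the remaining dissipation.
    have h := mul_nonneg (inv_nonneg.2 hdpos.le) (sq_nonneg (d * ‖ξ‖ - Λ * |y|))
    have h' : d⁻¹ * (d * ‖ξ‖ - Λ * |y|) ^ 2 =
        d * ‖ξ‖ ^ 2 - 2 * (Λ * ‖ξ‖ * |y|) + Λ ^ 2 / d * |y| ^ 2 := by
      field_simp
      ring
    rw [h', sq_abs] at h
    linarith
  have h5 : l * y * y ≤ |Λ| * y ^ 2 := by
    have : l ≤ |Λ| := (le_abs_self l).trans (hl.trans (le_abs_self Λ))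
    nlinarith [mul_le_mul_of_nonneg_right this (sq_nonneg y)]
  have h6 : 2 * (z * y) ≤ e * z ^ 2 + e⁻¹ * y ^ 2 := by
    have h := mul_nonneg (inv_nonneg.2 he.le) (sq_nonneg (e * z - y))
    have h' : e⁻¹ * (e * z - y) ^ 2 = e * z ^ 2 - 2 * (z * y) + e⁻¹ * y ^ 2 := by
      field_simp
      ring
    linarith
  have h7 : energyConstant δ Λ e * y ^ 2 =
      Λ ^ 2 / d * y ^ 2 + 2 * (|Λ| * y ^ 2) + e⁻¹ * y ^ 2 := by
    rw [energyConstant, hd, hq]; ring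
  have h8 : 2 * (1 - q) * (δ * ‖ξ‖ ^ 2) = d * ‖ξ‖ ^ 2 := by rw [hd]; ring
  rw [h7]
  rw [h8] at h2
  linarith


/-! ### The estimate at a fixed time -/

theorem SliceOperators.energy_estimate {n : ℕ} {c : Coefficients n} {D : Set (E n)} {s δ Λ e : ℝ}
    (S : SliceOperators c D s) (hδ : 0 < δ) (he : 0 < e)
    (hx : ∀ᵐ x ∂(spaceMeasure D), (c.b x s).IsSymm ∧
      (∀ ξ : E n, δ * ‖ξ‖ ^ 2 ≤ ξ.ofLp ⬝ᵥ (c.b x s *ᵥ ξ.ofLp)) ∧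
      ‖c.f x s‖ ≤ Λ ∧ |c.lam x s| ≤ Λ) (v : H1 D) (F : H0Vec D) (F₀ : H0 D) :
    2 * (c.form s v v - inner ℝ F v.grad + inner ℝ F₀ v.val) ≤
      (1 / 2 + e) * c.invForm s F + e * ‖F₀‖ ^ 2 + energyConstant δ Λ e * ‖v.val‖ ^ 2 := by
  rw [S.form_eq, S.invForm_eq, ← real_inner_self_eq_norm_sq F₀, ← real_inner_self_eq_norm_sq v.val]
  have i1 := L2.integrable_inner (𝕜 := ℝ) (S.b v.grad) v.grad
  have i2 := L2.integrable_inner (𝕜 := ℝ) (S.f v.grad) v.val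
  have i3 := L2.integrable_inner (𝕜 := ℝ) (S.lam v.val) v.val
  have i4 := L2.integrable_inner (𝕜 := ℝ) F v.grad
  have i5 := L2.integrable_inner (𝕜 := ℝ) F₀ v.val
  have i6 := L2.integrable_inner (𝕜 := ℝ) (S.binv F) F
  have i7 := L2.integrable_inner (𝕜 := ℝ) F₀ F₀
  have i8 := L2.integrable_inner (𝕜 := ℝ) v.val v.val
  simp only [L2.inner_def]
  rw [← integral_neg, ← integral_add i1.fun_neg i2, ← integral_add (i1.fun_neg.fun_add i2) i3,
    ← integral_sub ((i1.fun_neg.fun_add i2).fun_add i3) i4,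
    ← integral_add (((i1.fun_neg.fun_add i2).fun_add i3).sub' i4) i5,
    ← integral_const_mul, ← integral_const_mul, ← integral_const_mul, ← integral_const_mul,
    ← integral_add (i6.const_mul _) (i7.const_mul _),
    ← integral_add ((i6.const_mul _).fun_add (i7.const_mul _)) (i8.const_mul _)]
  refine integral_mono_ae (((((i1.fun_neg.fun_add i2).fun_add i3).sub' i4).fun_add i5).const_mul 2)
    (((i6.const_mul _).fun_add (i7.const_mul _)).fun_add (i8.const_mul _)) ?_
  filter_upwards [hx, S.b_apply v.grad, S.f_apply v.grad, S.lam_apply v.val, S.binv_apply F]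
    with x ⟨hs, hA, hf, hl⟩ h1 h2 h3 h4
  have key := pointwise_energy_estimate (l := c.lam x s) (y := v.val x) (z := F₀ x) (ξ := v.grad x)
    (F := F x) hδ he hs hA hf hl
  simp only [h1, h2, h3, h4]
  rw [dotProduct_eq_inner, dotProduct_eq_inner] at key
  rw [real_inner_comm (v.grad x), real_inner_comm (F x)]
  simp only [RCLike.inner_apply, conj_trivial] at *
  linarith

theorem Coefficients.invForm_nonneg {n : ℕ} {c : Coefficients n} {D : Set (E n)} {s δ : ℝ}
    (hδ : 0 < δ)
    (hx : ∀ᵐ x ∂(spaceMeasure D), ∀ ξ : E n, δ * ‖ξ‖ ^ 2 ≤ ξ.ofLp ⬝ᵥ (c.b x s *ᵥ ξ.ofLp))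
    (F : H0Vec D) : 0 ≤ c.invForm s F :=
  integral_nonneg_of_ae (by
    filter_upwards [hx] with x hx using dotProduct_mulVec_inv_nonneg hδ hx _)

theorem Coefficients.ae_pointwise_bounds {n : ℕ} {c : Coefficients n} {D : Set (E n)}
    {T δ Λ : ℝ} (hD : IsOpen D) (hc : c.IsAdmissible D T δ) (hΛ : c.EssBoundedBy D T Λ) :
    ∀ᵐ s ∂(timeMeasure T), ∀ᵐ x ∂(spaceMeasure D), (c.b x s).IsSymm ∧
      (∀ ξ : E n, δ * ‖ξ‖ ^ 2 ≤ ξ.ofLp ⬝ᵥ (c.b x s *ᵥ ξ.ofLp)) ∧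
      ‖c.f x s‖ ≤ Λ ∧ |c.lam x s| ≤ Λ := by
  refine ae_ae_slice (p := fun p => (c.b p.1 p.2).IsSymm ∧
      (∀ ξ : E n, δ * ‖ξ‖ ^ 2 ≤ ξ.ofLp ⬝ᵥ (c.b p.1 p.2 *ᵥ ξ.ofLp)) ∧
      ‖c.f p.1 p.2‖ ≤ Λ ∧ |c.lam p.1 p.2| ≤ Λ) ?_
  have hmeas : MeasurableSet (cylinder D T) := hD.measurableSet.prod measurableSet_Ioo
  filter_upwards [hΛ, ae_restrict_mem hmeas] with p h1 h2
  refine ⟨hc.symm p h2, hc.coercive p h2, ?_, ?_⟩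
  · linarith [frobNorm_nonneg (c.b p.1 p.2), abs_nonneg (c.lam p.1 p.2)]
  · linarith [frobNorm_nonneg (c.b p.1 p.2), norm_nonneg (c.f p.1 p.2)]

/-! ### The energy estimate for solutions -/

theorem memLp_riesz {α V : Type*} [MeasurableSpace α] {μ : Measure α} [NormedAddCommGroup V]
    [InnerProductSpace ℝ V] [CompleteSpace V] {g : α → StrongDual ℝ V} (hg : MemLp g 2 μ) :
    MemLp (fun s => (InnerProductSpace.toDual ℝ V).symm (g s)) 2 μ :=
  hg.of_le_mul (c := 1)
    ((InnerProductSpace.toDual ℝ V).symm.continuous.comp_aestronglyMeasurable hg.1)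
    (Eventually.of_forall fun s => by simp)

theorem timeMeasure_restrict_Ioc {t T : ℝ} (ht : t ≤ T) :
    (volume : Measure ℝ).restrict (Ioc 0 t) ≤ timeMeasure T :=
  Measure.restrict_mono_set volume (Ioc_subset_Icc_self.trans (Icc_subset_Icc_right ht))

theorem ae_Ioc_of_timeMeasure {t T : ℝ} (ht : t ≤ T) {p : ℝ → Prop}
    (h : ∀ᵐ s ∂(timeMeasure T), p s) : ∀ᵐ s ∂((volume : Measure ℝ).restrict (Ioc 0 t)), p s :=
  ae_mono (timeMeasure_restrict_Ioc ht) h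

theorem intervalIntegrable_of_timeMeasure {t T : ℝ} (h0 : 0 ≤ t) (ht : t ≤ T) {g : ℝ → ℝ}
    (hg : Integrable g (timeMeasure T)) : IntervalIntegrable g volume 0 t :=
  (intervalIntegrable_iff_integrableOn_Ioc_of_le h0).2
    (hg.mono_measure (timeMeasure_restrict_Ioc ht))

theorem integral_congr_timeMeasure {t T : ℝ} (h0 : 0 ≤ t) (ht : t ≤ T) {g h : ℝ → ℝ}
    (hgh : ∀ᵐ s ∂(timeMeasure T), g s = h s) : ∫ s in (0 : ℝ)..t, g s = ∫ s in (0 : ℝ)..t, h s := by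
  rw [intervalIntegral.integral_of_le h0, intervalIntegral.integral_of_le h0]
  exact integral_congr_ae (ae_Ioc_of_timeMeasure ht hgh)

/-- Of the `2K∫e^{-2Ks}‖u‖²` supplied by the energy inequality, the share `energyConstant δ Λ e`
cancels the zero-order term of the estimate at fixed time, and `L` is left over. -/
theorem IsSolution.energy_estimate {n : ℕ} {T δ Λ e K L : ℝ} (hT : 0 < T) {D : Set (E n)}
    (hD : IsOpen D) (hδ : 0 < δ) (he : 0 < e) (hK : 0 ≤ K)
    (hL : 2 * K = L + energyConstant δ Λ e) {c : Coefficients n} (hc : c.IsAdmissible D T δ)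
    (hΛ : c.EssBoundedBy D T Λ) {φ : Xneg D T} {F : X0Vec D T} {F₀ : X0 D T}
    (hφ : IsDivergenceForm φ F F₀) {u : Y1 D T} (hu : IsSolution c φ u) (t : Icc (0 : ℝ) T) :
    Real.exp (-2 * K * t) * ‖u.toC0 t‖ ^ 2
        + L * ∫ s in (0 : ℝ)..t, Real.exp (-2 * K * s) * ‖(u.toX1 s).val‖ ^ 2
      ≤ (1 / 2 + e) * (∫ s in (0 : ℝ)..t, c.invForm s (F s)) + e * ∫ s in (0 : ℝ)..t, ‖F₀ s‖ ^ 2 := by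
  obtain ⟨t, ht⟩ := t
  simp only
  have hIoc : ∀ {s : ℝ}, s ∈ Icc 0 t → s ∈ Icc 0 T := fun hs => ⟨hs.1, hs.2.trans ht.2⟩
  set w : ℝ → H0 D := fun s => u.toC0 (projIcc 0 T hT.le s) with hw
  have hwc : Continuous w := u.toC0.continuous.comp continuous_projIcc
  have hwe : ∀ s (hs : s ∈ Icc 0 T), w s = u.toC0 ⟨s, hs⟩ := fun s hs => by
    simp only [hw, projIcc_of_mem hT.le hs]
  have hwU : ∀ᵐ s ∂(timeMeasure T), (u.toX1 s).val = w s := by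
    filter_upwards [u.ae_eq, ae_restrict_mem measurableSet_Icc] with s h1 h2
    rw [hwe s h2, h1 h2]
  -- The Riesz representatives of `𝒜u` and `φ` turn the equation in `H⁻¹` into one for `H¹`-valued
  -- functions.
  obtain ⟨G, hG, hGe⟩ := hc.exists_form_representative u.toX1
  have hφm := memLp_riesz (Lp.memLp φ)
  have hU := Lp.memLp u.toX1
  have hGφ : ∀ᵐ s ∂(timeMeasure T), ∀ v,
      inner ℝ (G s + (InnerProductSpace.toDual ℝ (H1 D)).symm (φ s)) v =
        c.form s (u.toX1 s) v + φ s v := by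
    filter_upwards [hGe] with s hs v
    rw [inner_add_left, hs, InnerProductSpace.toDual_symm_apply]
  have henergy := energy_inequality (H1.valL D) (K := K) ht.1 hwc.continuousOn
    (by rw [hwe 0 ⟨le_rfl, hT.le⟩]; exact hu.initial _ rfl)
    (hU.mono_measure (timeMeasure_restrict_Ioc ht.2))
    (ae_Ioc_of_timeMeasure ht.2 hwU)
    ((hG.add hφm).mono_measure (timeMeasure_restrict_Ioc ht.2))
    (fun s hs v => by
      rw [hwe s (hIoc hs), H1.valL_apply, hu.equation]
      refine (integral_congr_timeMeasure hs.1 (hIoc hs).2 ?_).symm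
      filter_upwards [hGφ] with r hr using hr v)
  rw [hwe t ht] at henergy
  have hθ : Continuous fun s : ℝ => Real.exp (-2 * K * s) := by fun_prop
  have hEint : IntervalIntegrable (fun s => Real.exp (-2 * K * s) * ‖w s‖ ^ 2) volume 0 t :=
    Continuous.intervalIntegrable (by fun_prop) _ _
  have hinv := intervalIntegrable_of_timeMeasure ht.1 ht.2 (hc.integrable_invForm F)
  have hF₀ := intervalIntegrable_of_timeMeasure ht.1 ht.2
    ((memLp_two_iff_integrable_sq_norm (Lp.memLp F₀).1).1 (Lp.memLp F₀))
  have hpair := (intervalIntegrable_of_timeMeasure ht.1 ht.2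
    (memLp_two_inner_integrable (hG.add hφm) hU)).continuousOn_mul hθ.continuousOn
  obtain ⟨C, -, hS⟩ := hc.exists_sliceOperators
  have hae : ∀ᵐ s ∂(timeMeasure T), 2 * (Real.exp (-2 * K * s) *
      inner ℝ ((G + fun s => (InnerProductSpace.toDual ℝ (H1 D)).symm (φ s)) s) (u.toX1 s)) ≤
      (1 / 2 + e) * c.invForm s (F s) + e * ‖F₀ s‖ ^ 2 +
        energyConstant δ Λ e * (Real.exp (-2 * K * s) * ‖w s‖ ^ 2) := by
    filter_upwards [hS, hGφ, hφ, hwU, c.ae_pointwise_bounds hD hc hΛ,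
      ae_restrict_mem measurableSet_Icc] with s ⟨S, _⟩ h1 h2 h3 h4 h5
    have h6 := S.energy_estimate hδ he h4 (u.toX1 s) (F s) (F₀ s)
    have h7 := c.invForm_nonneg hδ (h4.mono fun x hx => hx.2.1) (F s)
    rw [Pi.add_apply, h1, h2, ← h3]
    -- The weight is dropped from the data terms, which are nonnegative, but kept on `‖u‖²`, where
    -- it must match the left side.
    have h8 : Real.exp (-2 * K * s) ≤ 1 := by
      rw [Real.exp_le_one_iff]
      nlinarith [mul_nonneg hK h5.1]
    have h9 := mul_le_mul_of_nonneg_left h6 (Real.exp_pos (-2 * K * s)).le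
    have h10 : 0 ≤ (1 / 2 + e) * c.invForm s (F s) + e * ‖F₀ s‖ ^ 2 := by positivity
    have h11 := mul_le_mul_of_nonneg_right h8 h10
    linarith
  have hmono := intervalIntegral.integral_mono_ae_restrict ht.1 (hpair.const_mul 2)
    (((hinv.const_mul (1 / 2 + e)).add (hF₀.const_mul e)).add
      (hEint.const_mul (energyConstant δ Λ e)))
    (ae_mono (Measure.restrict_mono (Icc_subset_Icc_right ht.2) le_rfl) hae)
  simp only [Pi.add_apply] at hmono
  rw [intervalIntegral.integral_const_mul, intervalIntegral.integral_add
    ((hinv.const_mul (1 / 2 + e)).add (hF₀.const_mul e)) (hEint.const_mul _),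
    intervalIntegral.integral_add (hinv.const_mul (1 / 2 + e)) (hF₀.const_mul e),
    intervalIntegral.integral_const_mul, intervalIntegral.integral_const_mul,
    intervalIntegral.integral_const_mul] at hmono
  have hval : (∫ s in (0 : ℝ)..t, Real.exp (-2 * K * s) * ‖(u.toX1 s).val‖ ^ 2) =
      ∫ s in (0 : ℝ)..t, Real.exp (-2 * K * s) * ‖w s‖ ^ 2 :=
    integral_congr_timeMeasure ht.1 ht.2 (by
      filter_upwards [hwU] with s hs
      rw [hs])
  rw [hval]
  simp only [Pi.add_apply] at henergy
  rw [hL] at henergy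
  linarith

end Parabolic

/-! ### Choice of `K` and passage to the supremum -/

open Parabolic in
theorem corollary1 (n : ℕ) (T : ℝ) (hT : 0 < T)
    (D : Set (EuclideanSpace ℝ (Fin n))) (hD : IsSpatialDomain D)
    (δ : ℝ) (hδ : 0 < δ) (Λ : ℝ) (M ε : ℝ) (hM : 0 < M) (hε : 0 < ε) :
    ∃ K : ℝ, 0 ≤ K ∧
      ∀ c : Coefficients n, c.IsAdmissible D T δ → c.EssBoundedBy D T Λ →
      ∀ (φ : Xneg D T) (F : X0Vec D T) (F₀ : X0 D T), IsDivergenceForm φ F F₀ →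
      ∀ u : Y1 D T, IsSolution c φ u →
      ∀ t : Set.Icc (0 : ℝ) T,
        sSup ((fun s : Set.Icc (0 : ℝ) T => Real.exp (-2 * K * s) * ‖u.toC0 s‖ ^ 2) '' Set.Iic t)
          + M * ∫ s in (0 : ℝ)..t, Real.exp (-2 * K * s) * ‖(u.toX1 s).val‖ ^ 2
        ≤ (1 / 2 + ε) * (∫ s in (0 : ℝ)..t, c.invForm s (F s))
          + ε * ∫ s in (0 : ℝ)..t, ‖F₀ s‖ ^ 2 := by
  have he : 0 < ε / 4 := by positivity
  -- With `L = M/κ` the supremum costs one copy of the right side at level `ε/4` and the `M`-term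
  -- costs `κ` copies. Since `κ ≤ min(1, ε)`, the factor `(1 + κ)(1/2 + ε/4)` is at most `1/2 + ε`.
  set κ := ε / (1 + ε) with hκ
  have hκ0 : 0 < κ := by positivity
  have hκ1 : κ ≤ 1 := (div_le_one (by positivity)).2 (by linarith)
  have hκε : κ ≤ ε := div_le_self hε.le (by linarith)
  have hC := energyConstant_nonneg (Λ := Λ) hδ he
  have hL : 0 < M / κ := by positivity
  refine ⟨(M / κ + energyConstant δ Λ (ε / 4)) / 2, by positivity, ?_⟩
  set K := (M / κ + energyConstant δ Λ (ε / 4)) / 2 with hK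
  intro c hc hΛ φ F F₀ hφ u hu t
  have key := fun s => hu.energy_estimate hT hD.1 hδ he (K := K) (L := M / κ) (by positivity)
    (by rw [hK]; ring) hc hΛ hφ s
  have hI : ∀ s : Set.Icc (0 : ℝ) T, s ≤ t →
      (∫ r in (0 : ℝ)..s, c.invForm r (F r)) ≤ ∫ r in (0 : ℝ)..t, c.invForm r (F r) := by
    intro s hst
    refine intervalIntegral.integral_mono_interval le_rfl s.2.1 hst ?_
      (intervalIntegrable_of_timeMeasure t.2.1 t.2.2 (hc.integrable_invForm F))
    refine ae_Ioc_of_timeMeasure t.2.2 ?_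
    filter_upwards [c.ae_pointwise_bounds hD.1 hc hΛ] with r hr
    exact c.invForm_nonneg hδ (hr.mono fun x hx => hx.2.1) (F r)
  have hJ : ∀ s : Set.Icc (0 : ℝ) T, s ≤ t →
      (∫ r in (0 : ℝ)..s, ‖F₀ r‖ ^ 2) ≤ ∫ r in (0 : ℝ)..t, ‖F₀ r‖ ^ 2 := fun s hst =>
    intervalIntegral.integral_mono_interval le_rfl s.2.1 hst
      (Filter.Eventually.of_forall fun r => sq_nonneg _)
      (intervalIntegrable_of_timeMeasure t.2.1 t.2.2
        ((memLp_two_iff_integrable_sq_norm (Lp.memLp F₀).1).1 (Lp.memLp F₀)))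
  have hN : ∀ s : Set.Icc (0 : ℝ) T,
      0 ≤ ∫ r in (0 : ℝ)..s, Real.exp (-2 * K * r) * ‖(u.toX1 r).val‖ ^ 2 := fun s =>
    intervalIntegral.integral_nonneg s.2.1 fun r _ => by positivity
  set I := ∫ r in (0 : ℝ)..t, c.invForm r (F r)
  set N := ∫ r in (0 : ℝ)..t, ‖F₀ r‖ ^ 2
  have hzero : (⟨0, le_rfl, hT.le⟩ : Set.Icc (0 : ℝ) T) ≤ t := t.2.1
  have hI0 : 0 ≤ I := by simpa using hI _ hzero
  have hN0 : 0 ≤ N := by simpa using hJ _ hzero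
  -- The data integrals increase with time, so the estimate at any `s ≤ t` is bounded by its right
  -- side at `t`.
  have hsup : sSup ((fun s : Set.Icc (0 : ℝ) T => Real.exp (-2 * K * s) * ‖u.toC0 s‖ ^ 2) ''
      Set.Iic t) ≤ (1 / 2 + ε / 4) * I + ε / 4 * N := by
    refine csSup_le (Set.nonempty_Iic.image _) ?_
    rintro _ ⟨s, hs, rfl⟩
    have h1 := mul_nonneg hL.le (hN s)
    have h2 := mul_le_mul_of_nonneg_left (hI s hs) (by positivity : 0 ≤ 1 / 2 + ε / 4)
    have h3 := mul_le_mul_of_nonneg_left (hJ s hs) he.le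
    have h4 := key s
    simp only
    linarith
  -- The estimate at `t` without its endpoint term, multiplied by `κ`.
  have hint : M * (∫ s in (0 : ℝ)..t, Real.exp (-2 * K * s) * ‖(u.toX1 s).val‖ ^ 2) ≤
      κ * ((1 / 2 + ε / 4) * I + ε / 4 * N) := by
    have h1 : 0 ≤ Real.exp (-2 * K * t) * ‖u.toC0 t‖ ^ 2 := by positivity
    have h2 := mul_le_mul_of_nonneg_left (le_trans (le_add_of_nonneg_left h1) (key t)) hκ0.le
    rwa [← mul_assoc, mul_div_cancel₀ M hκ0.ne'] at h2
  have h1 : (1 + κ) * (1 / 2 + ε / 4) ≤ 1 / 2 + ε := by nlinarith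
  have h2 : (1 + κ) * (ε / 4) ≤ ε := by nlinarith
  have h3 := mul_le_mul_of_nonneg_right h1 hI0
  have h4 := mul_le_mul_of_nonneg_right h2 hN0
  linarith
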